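/- **Theorem.** *Model.* Let $T, M \ge 1$ and let $X(1), \ldots, X(T)$ be random vectors in $\mathbb Z^M$. Write $\mathcal X(t) = (X(1), \ldots, X(t))$. Let $v \in \mathbb R$, $g_t : \mathbb R^{M \times t} \to \mathbb R^M$ ($1 \le t < T$) and $A^*(t) \in \mathbb R^{M \times M}$ ($1 \le t \le T$). Assume that for $1 \le t < T$, given $\mathcal X(t)$, the coordinates of $X(t+1)$ are independent and $X_m(t+1)$ is Poisson with mean $\exp\{v + A^*_m(t)\, g_t(\mathcal X(t))\}$, where $A_m$ denotes the $m$-th row of $A$. There are $K \ge 0$ and integers $1 = \eta_0 < \eta_1 < \cdots < \eta_K < \eta_{K+1} = T+1$ such that, for $2 \le t \le T$, $A^*(t) \ne A^*(t-1)$ if and only if $t \in \{\eta_1, \ldots, \eta_K\}$. Put $\Delta = \min_{1 \le k \le K+1} (\eta_k - \eta_{k-1})$ and $\kappa = \min_{1 \le k \le K} \|A^*(\eta_k) - A^*(\eta_{k-1})\|_{\mathrm F}$; if $K = 0$, let $\kappa$ be any positive number. *Assumptions*, with constants $p \in \{1, 2, \ldots\}$ and $\omega, C_g, C_{\Delta,1},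 C_{\Delta,2}, \xi > 0$: - **A1.** There is a nonempty set $S \subset \{1, \ldots, M\}^2$ with $|S| = d$ such that $A^*_{m,m'}(t) = 0$ for all $t$ and all $(m,m') \notin S$. - **A2.** $\|A^*_m(t)\|_1 \le 1$ for all $t$ and $m$. - **A3.** $\Delta \ge C_{\Delta,1} T$ and $\Delta \ge C_{\Delta,2} \log^{2+\xi}(TM)\, d^2 \max\{\kappa^{-2}, \kappa^{-4}\}$. - **A4.** For all $p < t < T$, the matrix $\mathbb E[g_t(\mathcal X(t)) g_t(\mathcal X(t))^\top \mid \mathcal X(t-p)] - \omega I_M$ is almost surely positive definite. Moreover $|v| \le C_g$ and $\|g_t(\cdot)\|_\infty \le C_g$ for all $1 \le t < T$. *Estimator.* For $\lambda, \gamma > 0$, an integer interval $I \subset \{1, \ldots, T\}$ and $A \in \mathbb R^{M \times M}$, let $$H(A, I) = \sum_{t \in I,\, t < T} \sum_{m=1}^M \Big( \exp\{v + A_m g_t(\mathcal X(t))\} - X_m(t+1) \{v + A_m g_t(\mathcal X(t))\} \Big) + \lambda |I|^{1/2} \sum_{m,m'} |A_{m,m'}|,$$ and let $\widehat A(I)$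 be a minimizer of $H(\cdot, I)$ over $\{A : \max_m \|A_m\|_1 \le 1\}$. Let $\widehat{\mathcal P}$ minimize $\sum_{I \in \mathcal P} H(\widehat A(I), I) + \gamma |\mathcal P|$ over all partitions $\mathcal P$ of $\{1, \ldots, T\}$ into nonempty integer intervals. Put $\widehat K = |\widehat{\mathcal P}| - 1$ and let $\widehat\eta_1 < \cdots < \widehat\eta_{\widehat K}$ be the left endpoints, other than $1$, of the intervals of $\widehat{\mathcal P}$. *Conclusion.* For all $p, \omega, C_g, C_{\Delta,1}$ there are positive constants $C_\lambda, C_\gamma, C_\epsilon, C_0$, depending only on these four numbers, such that the following holds whenever the model satisfies A1–A4 (for any $\xi, C_{\Delta,2} > 0$) and $C_{\Delta,2} \log^{\xi}(TM) \ge C_0$, that is, whenever $C_{\Delta,2}$ or $TM$ is large enough. If $\lambda = C_\lambda \log(TM)$ and $\gamma = C_\gamma \log^2(TM)\, d (1 + d \kappa^{-2})$, then with probability at least $1 - 2(TM)^{-1}$, for every choice of the minimizers, $$\widehat K = K \quad \text{and} \quad |\widehat\eta_k - \eta_k| \le C_\epsilon\, d^2 \log^2(TM) \max\{\kappa^{-2},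 \kappa^{-4}\} \quad \text{for all } 1 \le k \le K.$$ -/

import Mathlib

open MeasureTheory ProbabilityTheory
open scoped NNReal ENNReal

namespace SEPP

/-- A partition of the integer interval `{1, …, T}` into `K + 1` nonempty integer intervals
`{η 0, …, η 1 - 1}, {η 1, …, η 2 - 1}, …, {η K, …, η (K + 1) - 1}`, where
`1 = η 0 < η 1 < ⋯ < η K < η (K + 1) = T + 1`. The values `η k` for `k > K + 1` play no role.
The points `η 1, …, η K` are the change points of the partition. -/
structure IntervalPartition (T : ℕ) where
  K : ℕ
  η : ℕ → ℕ
  first : η 0 = 1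
  last : η (K + 1) = T + 1
  lt_succ : ∀ k ≤ K, η k < η (k + 1)

/-- The minimal spacing `Δ = min_{k = 1, …, K + 1} (η k - η (k - 1))`. -/
def IntervalPartition.minSpacing {T : ℕ} (P : IntervalPartition T) : ℕ :=
  (Finset.range (P.K + 1)).inf' ⟨0, by simp⟩ (fun k => P.η (k + 1) - P.η k)

variable {M : ℕ}

/-- Frobenius norm of a matrix. -/
noncomputable def frobNorm (A : Matrix (Fin M) (Fin M) ℝ) : ℝ :=
  Real.sqrt (∑ i, ∑ j, A i j ^ 2)

/-- Entrywise `ℓ₁`-norm of a matrix. -/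
def l1Norm (A : Matrix (Fin M) (Fin M) ℝ) : ℝ := ∑ i, ∑ j, |A i j|

/-- Matrices all of whose rows have `ℓ₁`-norm at most one. -/
def rowBall (M : ℕ) : Set (Matrix (Fin M) (Fin M) ℝ) := {A | ∀ m, ∑ j, |A m j| ≤ 1}

/-- The history `(x(1), …, x(t))` of a path `x`, as an `M × t` matrix of integers. -/
def history (x : ℕ → Fin M → ℤ) (t : ℕ) : Matrix (Fin M) (Fin t) ℤ :=
  Matrix.of fun m s => x (s + 1) m

/-- A family of functions `g_t : ℝ^{M × t} → ℝ^M`. -/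
abbrev Features (M : ℕ) : Type := (t : ℕ) → Matrix (Fin M) (Fin t) ℝ → Fin M → ℝ

/-- The vector `g_t(h)` for a history `h` with integer entries. -/
def feature (g : Features M) {t : ℕ} (h : Matrix (Fin M) (Fin t) ℤ) : Fin M → ℝ :=
  g t (h.map (fun z : ℤ => (z : ℝ)))

/-- The log-intensity `v + A_m g_t(h)` of coordinate `m`, where `A_m` is row `m` of `A`. -/
def logIntensity (v : ℝ) (g : Features M) (A : Matrix (Fin M) (Fin M) ℝ) {t : ℕ}
    (h : Matrix (Fin M) (Fin t) ℤ) (m : Fin M) : ℝ :=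
  v + ∑ j, A m j * feature g h j

/-! ### The estimator -/

/-- The penalized negative log-likelihood of `A` over the integer interval `I = {s, …, e}`:
the sum of the negative log-likelihoods of the observed transitions `t → t + 1` with `t ∈ I`
(that is, `t < T`), plus `lam * |I|^{1/2} * ‖A‖₁`. -/
noncomputable def penLoss (T : ℕ) (v : ℝ) (g : Features M) (lam : ℝ) (x : ℕ → Fin M → ℤ)
    (A : Matrix (Fin M) (Fin M) ℝ) (s e : ℕ) : ℝ :=
  (∑ t ∈ (Finset.Icc s e).filter (fun t => t < T), ∑ m,
      (Real.exp (logIntensity v g A (history x t) m)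
        - (x (t + 1) m : ℝ) * logIntensity v g A (history x t) m))
    + lam * Real.sqrt ((Finset.Icc s e).card : ℝ) * l1Norm A

/-- `Ahat s e` minimizes the penalized loss over `rowBall`, for each interval
`{s, …, e} ⊆ {1, …, T}`. -/
def IsPenalizedMLE (T : ℕ) (v : ℝ) (g : Features M) (lam : ℝ) (x : ℕ → Fin M → ℤ)
    (Ahat : ℕ → ℕ → Matrix (Fin M) (Fin M) ℝ) : Prop :=
  ∀ s e, 1 ≤ s → s ≤ e → e ≤ T →
    Ahat s e ∈ rowBall M ∧ ∀ A ∈ rowBall M,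
      penLoss T v g lam x (Ahat s e) s e ≤ penLoss T v g lam x A s e

/-- The objective `∑_{I ∈ P} H(Ahat(I), I) + gam * |P|`. -/
noncomputable def partitionCost (T : ℕ) (v : ℝ) (g : Features M) (lam gam : ℝ)
    (x : ℕ → Fin M → ℤ) (Ahat : ℕ → ℕ → Matrix (Fin M) (Fin M) ℝ)
    (P : IntervalPartition T) : ℝ :=
  (∑ k ∈ Finset.range (P.K + 1),
      penLoss T v g lam x (Ahat (P.η k) (P.η (k + 1) - 1)) (P.η k) (P.η (k + 1) - 1))
    + gam * ((P.K : ℝ) + 1)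

/-- `P` is an output of the penalized dynamic programming estimator on the path `x`: a minimizer
of the objective over all interval partitions of `{1, …, T}`. -/
def IsPDPEstimate (T : ℕ) (v : ℝ) (g : Features M) (lam gam : ℝ) (x : ℕ → Fin M → ℤ)
    (P : IntervalPartition T) : Prop :=
  ∃ Ahat : ℕ → ℕ → Matrix (Fin M) (Fin M) ℝ, IsPenalizedMLE T v g lam x Ahat ∧
    ∀ Q : IntervalPartition T,
      partitionCost T v g lam gam x Ahat P ≤ partitionCost T v g lam gam x Ahat Q

theorem IntervalPartition.le_η {T : ℕ} (P : IntervalPartition T) (k : ℕ) (hk : k ≤ P.K + 1) :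
    k + 1 ≤ P.η k := by
  induction k with
  | zero => simp [P.first]
  | succ n ih =>
    have h1 := P.lt_succ n (by omega)
    have h2 := ih (by omega)
    omega

theorem IntervalPartition.η_le {T : ℕ} (P : IntervalPartition T) (j : ℕ) (hj : j ≤ P.K + 1) :
    P.η (P.K + 1 - j) ≤ T + 1 := by
  induction j with
  | zero => simp [P.last]
  | succ n ih =>
    have h1 := P.lt_succ (P.K + 1 - (n + 1)) (by omega)
    have h2 := ih (by omega)
    have h3 : P.K + 1 - (n + 1) + 1 = P.K + 1 - n := by omega
    rw [h3] at h1
    omega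

theorem isCompact_rowBall (M : ℕ) : IsCompact (rowBall M) := by
  have h1 : IsCompact {A : Fin M → Fin M → ℝ | ∀ m, A m ∈ {r : Fin M → ℝ | ∀ j,
      r j ∈ Set.Icc (-1 : ℝ) 1}} :=
    isCompact_pi_infinite fun _ => isCompact_pi_infinite fun _ => isCompact_Icc
  refine h1.of_isClosed_subset ?_ ?_
  · have : rowBall M = ⋂ m, {A : Matrix (Fin M) (Fin M) ℝ | ∑ j, |A m j| ≤ 1} := by
      ext A; simp [rowBall]
    rw [this]
    exact isClosed_iInter fun m => isClosed_le (by fun_prop) continuous_const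
  · intro A hA m j
    have h2 : |A m j| ≤ ∑ j, |A m j| :=
      Finset.single_le_sum (f := fun j => |A m j|) (fun _ _ => abs_nonneg _) (Finset.mem_univ j)
    exact abs_le.mp (h2.trans (hA m))

/-- The penalized estimators exist. -/
theorem exists_isPenalizedMLE (T : ℕ) (v : ℝ) (g : Features M) (lam : ℝ) (x : ℕ → Fin M → ℤ) :
    ∃ Ahat, IsPenalizedMLE T v g lam x Ahat := by
  have key : ∀ s e, ∃ B ∈ rowBall M, ∀ A ∈ rowBall M,
      penLoss T v g lam x B s e ≤ penLoss T v g lam x A s e := by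
    intro s e
    have hne : (rowBall M).Nonempty := ⟨0, fun m => by simp⟩
    have hc : Continuous fun A : Matrix (Fin M) (Fin M) ℝ => penLoss T v g lam x A s e := by
      unfold penLoss logIntensity l1Norm
      fun_prop
    obtain ⟨B, hB, hmin⟩ := (isCompact_rowBall M).exists_isMinOn hne hc.continuousOn
    exact ⟨B, hB, fun A hA => hmin hA⟩
  choose B hB hmin using key
  exact ⟨B, fun s e _ _ _ => ⟨hB s e, hmin s e⟩⟩

/-- The penalized dynamic programming estimator exists on every path of length `T ≥ 1`. -/
theorem exists_isPDPEstimate (T : ℕ) (hT : 1 ≤ T) (v : ℝ) (g : Features M) (lam gam : ℝ)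
    (x : ℕ → Fin M → ℤ) : ∃ P, IsPDPEstimate T v g lam gam x P := by
  obtain ⟨Ahat, hA⟩ := exists_isPenalizedMLE T v g lam x
  have hfin : (Set.range (partitionCost T v g lam gam x Ahat)).Finite := by
    let G : Fin (T + 1) × (Fin (T + 2) → Fin (T + 2)) → ℝ := fun q =>
      (∑ k ∈ Finset.range (q.1.val + 1),
        penLoss T v g lam x
          (Ahat (q.2 (Fin.ofNat (T + 2) k)) ((q.2 (Fin.ofNat (T + 2) (k + 1)) : ℕ) - 1))
          (q.2 (Fin.ofNat (T + 2) k)) ((q.2 (Fin.ofNat (T + 2) (k + 1)) : ℕ) - 1))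
      + gam * ((q.1.val : ℝ) + 1)
    refine (Set.finite_range G).subset ?_
    rintro _ ⟨P, rfl⟩
    have hK := P.le_η (P.K + 1) le_rfl
    rw [P.last] at hK
    refine ⟨⟨⟨P.K, by omega⟩, fun i => Fin.ofNat (T + 2) (P.η i)⟩, ?_⟩
    have hη : ∀ k ≤ P.K + 1, P.η (k % (T + 2)) % (T + 2) = P.η k := by
      intro k hk
      have h1 := P.η_le (P.K + 1 - k) (by omega)
      have h2 : P.K + 1 - (P.K + 1 - k) = k := by omega
      rw [h2] at h1
      rw [Nat.mod_eq_of_lt (show k < T + 2 by omega), Nat.mod_eq_of_lt (by omega)]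
    simp only [G, partitionCost, Fin.val_ofNat]
    congr 1
    refine Finset.sum_congr rfl fun k hk => ?_
    have hk' := Finset.mem_range.mp hk
    rw [hη k (by omega), hη (k + 1) (by omega)]
  let P₀ : IntervalPartition T :=
    ⟨0, fun k => if k = 0 then 1 else T + 1, by simp, by simp, fun k hk => by
      have : k = 0 := by omega
      subst this
      simp
      omega⟩
  obtain ⟨_, ⟨P, rfl⟩, hP⟩ :=
    Set.exists_min_image _ (fun r : ℝ => r) hfin ⟨_, P₀, rfl⟩
  exact ⟨P, Ahat, hA, fun Q => hP _ ⟨Q, rfl⟩⟩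

/-! ### The model and the assumptions -/

/-- The `σ`-algebra generated by `X(1), …, X(t)`. -/
@[reducible] def sigmaHistory {Ω : Type*} (X : ℕ → Ω → Fin M → ℤ) (t : ℕ) : MeasurableSpace Ω :=
  ⨆ s ∈ Set.Icc 1 t, MeasurableSpace.comap (X s) inferInstance

/-- The self-exciting Poisson process with change points: the coefficient matrices `A(t)`,
`1 ≤ t ≤ T`, change exactly at the change points of `P`, and for `1 ≤ t < T`, given the history
up to time `t`, the coordinates of `X(t + 1)` are independent, coordinate `m` being Poisson with
intensity `exp(v + A_m(t) g_t(history))`. Histories take countably many values, so the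
conditional law is specified on each history of positive probability. -/
structure IsSEPP {Ω : Type*} [MeasurableSpace Ω] (μ : Measure Ω) (T : ℕ)
    (X : ℕ → Ω → Fin M → ℤ) (v : ℝ) (g : Features M)
    (A : ℕ → Matrix (Fin M) (Fin M) ℝ) (P : IntervalPartition T) : Prop where
  measurable : ∀ t, 1 ≤ t → t ≤ T → Measurable (X t)
  conditional_law : ∀ t, 1 ≤ t → t < T → ∀ h : Matrix (Fin M) (Fin t) ℤ,
    μ {w | history (fun s => X s w) t = h} ≠ 0 →
      (μ[|{w | history (fun s => X s w) t = h}]).map (X (t + 1)) =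
        Measure.pi (fun m =>
          (poissonMeasure (Real.exp (logIntensity v g (A t) h m)).toNNReal).map
            (fun n : ℕ => (n : ℤ)))
  change_iff : ∀ t, 2 ≤ t → t ≤ T →
    (A t ≠ A (t - 1) ↔ ∃ k, 1 ≤ k ∧ k ≤ P.K ∧ t = P.η k)

/-- `κ > 0` is the minimal jump size `min_{k = 1, …, K} ‖A(η k) - A(η (k - 1))‖_F`; if there is
no change point, `κ` may be any positive number. -/
def IsMinJump {T : ℕ} (A : ℕ → Matrix (Fin M) (Fin M) ℝ) (P : IntervalPartition T)
    (κ : ℝ) : Prop :=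
  0 < κ ∧ (1 ≤ P.K →
    IsLeast {r : ℝ | ∃ k, 1 ≤ k ∧ k ≤ P.K ∧ r = frobNorm (A (P.η k) - A (P.η (k - 1)))} κ)

/-- The entries of the coefficient matrices vanish outside `S`. -/
def SupportedOn (T : ℕ) (A : ℕ → Matrix (Fin M) (Fin M) ℝ) (S : Finset (Fin M × Fin M)) : Prop :=
  ∀ t, 1 ≤ t → t ≤ T → ∀ m m', (m, m') ∉ S → A t m m' = 0

/-- The spacing and signal-to-noise condition. -/
def SignalToNoise (T M d Δ : ℕ) (κ ξ C₁ C₂ : ℝ) : Prop :=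
  C₁ * (T : ℝ) ≤ (Δ : ℝ) ∧
  C₂ * Real.log ((T : ℝ) * M) ^ (2 + ξ) * (d : ℝ) ^ 2 * max (κ ^ (-2 : ℤ)) (κ ^ (-4 : ℤ))
    ≤ (Δ : ℝ)

/-- The restricted eigenvalue condition: `E[g_t g_tᵀ | X(1), …, X(t - p)] - ω I` is almost surely
positive definite, for all times for which it makes sense. -/
def RestrictedEigenvalue {Ω : Type*} [MeasurableSpace Ω] (μ : Measure Ω) (T : ℕ)
    (X : ℕ → Ω → Fin M → ℤ) (g : Features M) (p : ℕ) (ω : ℝ) : Prop :=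
  ∀ t, p < t → t < T → ∀ᵐ w ∂μ,
    ((Matrix.of fun i j : Fin M =>
        (μ[fun w' => feature g (history (fun s => X s w') t) i *
              feature g (history (fun s => X s w') t) j | sigmaHistory X (t - p)]) w)
      - ω • (1 : Matrix (Fin M) (Fin M) ℝ)).PosDef

/-- `v` and all the functions `g_t` are bounded by `Cg`. -/
def BoundedFeatures (T : ℕ) (v : ℝ) (g : Features M) (Cg : ℝ) : Prop :=
  |v| ≤ Cg ∧ ∀ t, 1 ≤ t → t < T → ∀ h m, |g t h m| ≤ Cg

end SEPP

/-!
The argument has a deterministic part, valid on every path on which two families of sums are small,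
and a probabilistic part, which shows that most paths are of this kind (`GoodPath`).

*Good paths.* Over all time intervals `I`, the sums over `t ∈ I` of the innovations
`X_m(t + 1) - E[X_m(t + 1) | X(1), …, X(t)]` times the features must be of order
`√|I| log (T M)`, and so must be the entries of the sum of
`g_t g_tᵀ - E[g_t g_tᵀ | X(1), …, X(t - p)]`. For both, exponential moments give Chernoff bounds
which survive a union bound (`IsSEPP.measure_not_goodPath_le`). The innovations are conditionally
centred Poisson variables; the Gram deviations telescope into `p` sums of bounded martingale
differences.

*Restricted convexity.* On a good path, if the true matrix is `B` throughout `I`, the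
log-likelihood loss of `A` exceeds that of `B` by at least
`c |I| ‖A - B‖_F² - lam₀ √|I| ‖A - B‖₁`
(`GoodPath.restrictedConvexity`). No lower bound on `|I|` is needed: the rows of `A - B` have
`ℓ₁`-norm at most `2`, so all quadratic error terms are linear in `‖A - B‖₁` up to constants.

*Intervals containing change points.* Let `I` be cut by the true change points into pieces `I_k`
with true matrices `B_k`. As `lam` dominates `lam₀` times the number of pieces, which is at most
`1 / C₁`, the penalized loss of `A` on `I` is at least the sum of the penalized losses of the `B_k`
on the `I_k`, plus a multiple of the signal `∑ |I_k| ‖A - B_k‖_F²`, minus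
`O(lam² d + lam² d² κ⁻²)` (`penalized_lower_bound`). The delicate point is that the penalty
`√|I| ‖A‖₁` on `I` is smaller than `∑ √|I_k| ‖A‖₁`. The difference is at most `d ∑ √|I_k|`, the sum
being over all pieces but the longest, and each of these pieces is controlled by the signal, since
`A` cannot be close to the matrices on both sides of a jump (`overlap_le_signal`).

*Comparison.* Summed over the estimated intervals, this bounds the objective of the estimated
partition from below by that of the true one, refined. The estimated partition being optimal, there
are at most as many estimated change points as true ones, and the total signal is `O(γ)`
(`signal_le_of_cost_le`). Hence no estimated interval extends far to both sides of a true change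
point, i.e. every true change point is close to an estimated one (`exists_close`). As true change
points are far apart, the two families match in order (`IntervalPartition.match_of_close`).
-/

namespace SEPP

/-! ### Interval partitions -/

namespace IntervalPartition

variable {T : ℕ} (P : IntervalPartition T)

theorem η_strictMono {i j : ℕ} (hij : i < j) (hj : j ≤ P.K + 1) : P.η i < P.η j := by
  induction j with
  | zero => omega
  | succ n ih =>
    have h1 := P.lt_succ n (by omega)
    rcases Nat.lt_succ_iff_lt_or_eq.mp hij with h | h
    · exact (ih h (by omega)).trans h1
    · exact h ▸ h1

theorem η_mono {i j : ℕ} (hij : i ≤ j) (hj : j ≤ P.K + 1) : P.η i ≤ P.η j := by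
  rcases hij.lt_or_eq with h | h
  · exact (P.η_strictMono h hj).le
  · rw [h]

theorem one_le_η {i : ℕ} (hi : i ≤ P.K + 1) : 1 ≤ P.η i := by
  have := P.le_η i hi
  omega

theorem η_le_succ {i : ℕ} (hi : i ≤ P.K + 1) : P.η i ≤ T + 1 := by
  rw [← P.last]
  exact P.η_mono hi le_rfl

theorem minSpacing_le {i : ℕ} (hi : i ≤ P.K) : P.minSpacing ≤ P.η (i + 1) - P.η i :=
  Finset.inf'_le (f := fun k => P.η (k + 1) - P.η k) (Finset.mem_range.mpr (by omega))

theorem add_minSpacing_le {i j : ℕ} (hij : i < j) (hj : j ≤ P.K + 1) :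
    P.η i + P.minSpacing ≤ P.η j := by
  have h1 := P.minSpacing_le (i := i) (by omega)
  have h2 := P.lt_succ i (by omega)
  have h3 := P.η_mono (i := i + 1) (j := j) hij hj
  omega

theorem mul_minSpacing_le : (P.K + 1) * P.minSpacing ≤ T := by
  have h : ∀ m ≤ P.K + 1, m * P.minSpacing + 1 ≤ P.η m := by
    intro m
    induction m with
    | zero => simp [P.first]
    | succ n ih =>
      intro hm
      have h1 := ih (by omega)
      have h2 := P.add_minSpacing_le (Nat.lt_succ_self n) hm
      have h3 : (n + 1) * P.minSpacing = n * P.minSpacing + P.minSpacing := by ring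
      have h4 : n.succ = n + 1 := rfl
      rw [h4] at h2
      omega
  have := h _ le_rfl
  rw [P.last] at this
  omega

/-- Cutting `{a, …, b - 1}` along the intervals of a partition. -/
theorem sum_pieces {a b : ℕ} (ha : 1 ≤ a) (hb : b ≤ T + 1) (f : ℕ → ℝ) :
    ∑ k ∈ Finset.range (P.K + 1), ∑ t ∈ Finset.Ico (max a (P.η k)) (min b (P.η (k + 1))), f t
      = ∑ t ∈ Finset.Ico a b, f t := by
  have key : ∀ m ≤ P.K + 1,
      ∑ k ∈ Finset.range m, ∑ t ∈ Finset.Ico (max a (P.η k)) (min b (P.η (k + 1))), f t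
        = ∑ t ∈ Finset.Ico a (min b (P.η m)), f t := by
    intro m
    induction m with
    | zero =>
      intro _
      rw [Finset.range_zero, Finset.sum_empty, Finset.Ico_eq_empty, Finset.sum_empty]
      rw [P.first]
      omega
    | succ n ih =>
      intro hn
      rw [Finset.sum_range_succ, ih (by omega)]
      have h1 := P.lt_succ n (by omega)
      rcases le_total (P.η n) a with h | h
      · rw [max_eq_left h, Finset.Ico_eq_empty (by omega), Finset.sum_empty, zero_add]
      · rw [max_eq_right h]
        rcases le_total (P.η n) b with h' | h'
        · rw [min_eq_right h']
          exact Finset.sum_Ico_consecutive _ h (by omega)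
        · rw [Finset.Ico_eq_empty (a := P.η n) (by omega), Finset.sum_empty, add_zero,
            min_eq_left h', min_eq_left (by omega)]
  rw [key _ le_rfl, P.last, min_eq_left hb]

/-- Every time of `{1, …, T}` lies in one of the intervals. -/
theorem exists_mem {t : ℕ} (h1 : 1 ≤ t) (hT : t ≤ T) :
    ∃ k ≤ P.K, P.η k ≤ t ∧ t < P.η (k + 1) := by
  have key : ∀ m ≤ P.K + 1, t < P.η m → ∃ k < m, P.η k ≤ t ∧ t < P.η (k + 1) := by
    intro m
    induction m with
    | zero => intro _ h; rw [P.first] at h; omega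
    | succ n ih =>
      intro hn h
      by_cases h2 : t < P.η n
      · obtain ⟨k, hk, h3⟩ := ih (by omega) h2
        exact ⟨k, by omega, h3⟩
      · exact ⟨n, by omega, by omega, h⟩
  obtain ⟨k, hk, h⟩ := key _ le_rfl (by rw [P.last]; omega)
  exact ⟨k, by omega, h⟩

/-- If every change point of `P` has a change point of `Q` within distance `ε`, the change points
of `P` are more than `2 ε` apart, and `Q` has no more change points than `P`, then the change
points of `P` and `Q` match in order. -/
theorem match_of_close (Q : IntervalPartition T) {ε : ℝ} (hsep : 2 * ε < P.minSpacing)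
    (hclose : ∀ i, 1 ≤ i → i ≤ P.K → ∃ k, 1 ≤ k ∧ k ≤ Q.K ∧ |(Q.η k : ℝ) - P.η i| ≤ ε)
    (hK : Q.K ≤ P.K) :
    Q.K = P.K ∧ ∀ k, 1 ≤ k → k ≤ P.K → |(Q.η k : ℝ) - P.η k| ≤ ε := by
  choose! f hf1 hfK hf using hclose
  have hmono : ∀ i, 1 ≤ i → i + 1 ≤ P.K → f i < f (i + 1) := by
    intro i h1 h2
    by_contra hcon
    have h3 := Q.η_mono (not_lt.mp hcon) (by have := hfK i h1 (by omega); omega)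
    have h4 := P.add_minSpacing_le (Nat.lt_succ_self i) (by omega)
    have h5 := abs_le.mp (hf i h1 (by omega))
    have h6 := abs_le.mp (hf (i + 1) (by omega) h2)
    have h3' : (Q.η (f (i + 1)) : ℝ) ≤ Q.η (f i) := by exact_mod_cast h3
    have h4' : (P.η i : ℝ) + P.minSpacing ≤ P.η (i + 1) := by exact_mod_cast h4
    linarith [h5.2, h6.1]
  have hlow : ∀ i, 1 ≤ i → i ≤ P.K → i ≤ f i := by
    intro i h1
    induction i, h1 using Nat.le_induction with
    | base => intro h; exact hf1 1 le_rfl h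
    | succ n hn ih =>
      intro h
      have h1 := ih (by omega)
      have h2 := hmono n hn h
      omega
  have hup : ∀ j, j < P.K → f (P.K - j) ≤ Q.K - j := by
    intro j
    induction j with
    | zero => intro h; simpa using hfK P.K (by omega) le_rfl
    | succ n ih =>
      intro h
      have h1 := ih (by omega)
      have h2 := hmono (P.K - (n + 1)) (by omega) (by omega)
      rw [show P.K - (n + 1) + 1 = P.K - n by omega] at h2
      omega
  have hKK : Q.K = P.K := by
    rcases Nat.eq_zero_or_pos P.K with h | h
    · omega
    · have h1 := hlow P.K h le_rfl
      have h2 := hfK P.K h le_rfl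
      omega
  refine ⟨hKK, fun k h1 h2 => ?_⟩
  have h3 := hlow k h1 h2
  have h4 := hup (P.K - k) (by omega)
  rw [show P.K - (P.K - k) = k by omega] at h4
  have h5 : f k = k := by omega
  have h6 := hf k h1 h2
  rwa [h5] at h6

end IntervalPartition

/-! ### Matrix norms and the support -/

variable {M : ℕ}

theorem frobNorm_nonneg (A : Matrix (Fin M) (Fin M) ℝ) : 0 ≤ frobNorm A := Real.sqrt_nonneg _

theorem frobNorm_sq (A : Matrix (Fin M) (Fin M) ℝ) : frobNorm A ^ 2 = ∑ i, ∑ j, A i j ^ 2 :=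
  Real.sq_sqrt (Finset.sum_nonneg fun _ _ => Finset.sum_nonneg fun _ _ => sq_nonneg _)

theorem frobNorm_sub_sq_le (A B C : Matrix (Fin M) (Fin M) ℝ) :
    frobNorm (B - C) ^ 2 ≤ 2 * frobNorm (A - B) ^ 2 + 2 * frobNorm (A - C) ^ 2 := by
  simp only [frobNorm_sq, Finset.mul_sum, ← Finset.sum_add_distrib]
  refine Finset.sum_le_sum fun i _ => Finset.sum_le_sum fun j _ => ?_
  simp only [Matrix.sub_apply]
  nlinarith [sq_nonneg ((A i j - B i j) + (A i j - C i j))]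

/-- The `ℓ₁`-norm of the entries of `A` with indices in `S`. -/
def l1On (S : Finset (Fin M × Fin M)) (A : Matrix (Fin M) (Fin M) ℝ) : ℝ :=
  ∑ q ∈ S, |A q.1 q.2|

theorem l1On_nonneg (S : Finset (Fin M × Fin M)) (A : Matrix (Fin M) (Fin M) ℝ) : 0 ≤ l1On S A :=
  Finset.sum_nonneg fun _ _ => abs_nonneg _

theorem l1Norm_eq (S : Finset (Fin M × Fin M)) (A : Matrix (Fin M) (Fin M) ℝ) :
    l1Norm A = l1On S A + l1On Sᶜ A := by
  unfold l1Norm l1On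
  rw [Finset.sum_add_sum_compl S (fun q : Fin M × Fin M => |A q.1 q.2|), Fintype.sum_prod_type]

theorem l1Norm_nonneg (A : Matrix (Fin M) (Fin M) ℝ) : 0 ≤ l1Norm A :=
  Finset.sum_nonneg fun _ _ => Finset.sum_nonneg fun _ _ => abs_nonneg _

theorem abs_apply_le_one {A : Matrix (Fin M) (Fin M) ℝ} (hA : A ∈ rowBall M) (i j : Fin M) :
    |A i j| ≤ 1 :=
  (Finset.single_le_sum (f := fun j => |A i j|) (fun _ _ => abs_nonneg _)
    (Finset.mem_univ j)).trans (hA i)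

theorem l1On_le_card (S : Finset (Fin M × Fin M)) {A : Matrix (Fin M) (Fin M) ℝ}
    (hA : A ∈ rowBall M) : l1On S A ≤ S.card := by
  refine (Finset.sum_le_sum fun q _ => abs_apply_le_one hA q.1 q.2).trans ?_
  simp

theorem l1On_le_frobNorm (S : Finset (Fin M × Fin M)) (A : Matrix (Fin M) (Fin M) ℝ) :
    l1On S A ≤ Real.sqrt S.card * frobNorm A := by
  rw [frobNorm, ← Real.sqrt_mul (Nat.cast_nonneg _)]
  refine Real.le_sqrt_of_sq_le ?_
  refine (sq_sum_le_card_mul_sum_sq).trans ?_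
  refine mul_le_mul_of_nonneg_left ?_ (Nat.cast_nonneg _)
  rw [← Fintype.sum_prod_type (f := fun q : Fin M × Fin M => A q.1 q.2 ^ 2)]
  simp only [sq_abs]
  exact Finset.sum_le_sum_of_subset_of_nonneg (Finset.subset_univ _) fun _ _ _ => sq_nonneg _

theorem l1Norm_sub_le {S : Finset (Fin M × Fin M)} (A : Matrix (Fin M) (Fin M) ℝ)
    {B : Matrix (Fin M) (Fin M) ℝ} (hB : ∀ m m', (m, m') ∉ S → B m m' = 0) :
    l1Norm (A - B) ≤ Real.sqrt S.card * frobNorm (A - B) + l1On Sᶜ A := by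
  rw [l1Norm_eq S]
  refine add_le_add (l1On_le_frobNorm S _) (Finset.sum_le_sum fun q hq => ?_)
  rw [Matrix.sub_apply, hB q.1 q.2 (by simpa using hq), sub_zero]

theorem l1Norm_le_add {S : Finset (Fin M × Fin M)} (A : Matrix (Fin M) (Fin M) ℝ)
    {B : Matrix (Fin M) (Fin M) ℝ} (hB : ∀ m m', (m, m') ∉ S → B m m' = 0) :
    l1Norm B ≤ l1On S A + Real.sqrt S.card * frobNorm (A - B) := by
  have h0 : l1On Sᶜ B = 0 :=
    Finset.sum_eq_zero fun q hq => by rw [hB q.1 q.2 (by simpa using hq), abs_zero]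
  rw [l1Norm_eq S, h0, add_zero]
  refine le_trans ?_ (add_le_add_right (l1On_le_frobNorm S (A - B)) _)
  unfold l1On
  rw [← Finset.sum_add_distrib]
  refine Finset.sum_le_sum fun q _ => ?_
  rw [Matrix.sub_apply]
  have h := abs_sub_abs_le_abs_sub (B q.1 q.2) (A q.1 q.2)
  rw [abs_sub_comm] at h
  linarith

/-! ### The penalized loss over an interval containing change points -/

/-- Absorption of the penalty. An interval of length at most `N` is cut into pieces of lengths
`n k`; `δ k`, `l k` are the Frobenius and `ℓ₁` distances of a matrix from the true matrix on piece
`k`, `a k` is the `ℓ₁`-norm of the latter, and `u`, `w` are the `ℓ₁`-norms of the matrix on and off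
the support. All pieces but `j₀` have length controlled by the signal `∑ n k * δ k ^ 2`, which
pays for the loss `√n k` that comes from splitting the penalty. -/
theorem penalty_absorption {K j₀ : ℕ} {n δ a l : ℕ → ℝ} {N c lam lam₀ d κ C₁ u w V : ℝ}
    (hj₀ : j₀ ≤ K) (hn : ∀ k ≤ K, 0 ≤ n k) (hnN : ∀ k ≤ K, n k ≤ N)
    (hδ : ∀ k ≤ K, 0 ≤ δ k)
    (ha : ∀ k ≤ K, a k ≤ u + Real.sqrt d * δ k) (hl : ∀ k ≤ K, l k ≤ Real.sqrt d * δ k + w)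
    (hu : 0 ≤ u) (hud : u ≤ d) (hw : 0 ≤ w) (hc : 0 < c) (hlam₀ : 0 ≤ lam₀)
    (hlam : (K + 1) * lam₀ ≤ lam) (hκ : 0 < κ) (hC₁ : 0 < C₁)
    (hV : V = ∑ k ∈ Finset.range (K + 1), n k * δ k ^ 2)
    (hsmall : ∀ k ≤ K, k ≠ j₀ → C₁ * n k * κ ^ 2 / 2 ≤ V) :
    ∑ k ∈ Finset.range (K + 1), lam * Real.sqrt (n k) * a k + c / 4 * V ≤
      c * V - lam₀ * ∑ k ∈ Finset.range (K + 1), Real.sqrt (n k) * l k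
        + lam * Real.sqrt N * (u + w)
        + ((K + 1) * (2 / c) * (lam ^ 2 * d)
          + (K + 1) * ((2 * (K + 1)) / (c * C₁) * (lam ^ 2 * d ^ 2 / κ ^ 2))) := by
  have hK : (0 : ℝ) < K + 1 := by positivity
  have hd : 0 ≤ d := hu.trans hud
  have hlam0 : lam₀ ≤ lam := by nlinarith [(Nat.cast_nonneg K : (0 : ℝ) ≤ K)]
  have hlamn : 0 ≤ lam := hlam₀.trans hlam0
  have hV0 : 0 ≤ V := by
    rw [hV]
    refine Finset.sum_nonneg fun k hk => ?_
    have := hn k (by have := Finset.mem_range.mp hk; omega)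
    positivity
  have hmem : ∀ {k}, k ∈ Finset.range (K + 1) → k ≤ K := fun hk => by
    have := Finset.mem_range.mp hk; omega
  -- the terms `√(n k) √d δ k` are absorbed by half of the signal
  have h1 : ∑ k ∈ Finset.range (K + 1), 2 * (lam * Real.sqrt (n k) * (Real.sqrt d * δ k))
      ≤ c / 2 * V + (K + 1) * (2 / c) * (lam ^ 2 * d) := by
    have : ∀ k ∈ Finset.range (K + 1), 2 * (lam * Real.sqrt (n k) * (Real.sqrt d * δ k))
        ≤ c / 2 * (n k * δ k ^ 2) + 2 / c * (lam ^ 2 * d) := by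
      intro k hk
      have e1 := Real.sq_sqrt (hn k (hmem hk))
      have e2 := Real.sq_sqrt hd
      have e3 : 0 ≤ (c / 2 * (Real.sqrt (n k) * δ k) - lam * Real.sqrt d) ^ 2 * (2 / c) := by
        positivity
      have e4 : (c / 2 * (Real.sqrt (n k) * δ k) - lam * Real.sqrt d) ^ 2 * (2 / c)
          = c / 2 * (Real.sqrt (n k) ^ 2 * δ k ^ 2) + 2 / c * (lam ^ 2 * Real.sqrt d ^ 2)
            - 2 * (lam * Real.sqrt (n k) * (Real.sqrt d * δ k)) := by
        field_simp
        ring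
      rw [e1, e2] at e4
      linarith
    refine (Finset.sum_le_sum this).trans (le_of_eq ?_)
    rw [Finset.sum_add_distrib, ← Finset.mul_sum, ← hV]
    simp
    ring
  -- the part off the support is absorbed by the penalty
  have h2 : ∑ k ∈ Finset.range (K + 1), lam₀ * (Real.sqrt (n k) * w) ≤ lam * Real.sqrt N * w := by
    have : ∀ k ∈ Finset.range (K + 1), lam₀ * (Real.sqrt (n k) * w)
        ≤ lam₀ * (Real.sqrt N * w) := by
      intro k hk
      have := Real.sqrt_le_sqrt (hnN k (hmem hk))
      gcongr
    refine (Finset.sum_le_sum this).trans ?_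
    simp only [Finset.sum_const, Finset.card_range, nsmul_eq_mul]
    push_cast
    have h3 : 0 ≤ Real.sqrt N * w := by positivity
    nlinarith [mul_le_mul_of_nonneg_right hlam h3]
  -- all pieces but one are short enough to be absorbed by a quarter of the signal
  have h3 : ∑ k ∈ Finset.range (K + 1), lam * u * Real.sqrt (n k) ≤ lam * u * Real.sqrt N
      + (c / 4 * V + (K + 1) * ((2 * (K + 1)) / (c * C₁) * (lam ^ 2 * d ^ 2 / κ ^ 2))) := by
    rw [← Finset.add_sum_erase _ _ (Finset.mem_range.mpr (Nat.lt_succ_of_le hj₀))]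
    have hq : lam * u * Real.sqrt (n j₀) ≤ lam * u * Real.sqrt N := by
      have := Real.sqrt_le_sqrt (hnN j₀ hj₀)
      gcongr
    refine add_le_add hq ?_
    have hQ : 0 ≤ c / (4 * (K + 1)) * V
        + (2 * (K + 1)) / (c * C₁) * (lam ^ 2 * d ^ 2 / κ ^ 2) := by positivity
    have : ∀ k ∈ (Finset.range (K + 1)).erase j₀, lam * u * Real.sqrt (n k)
        ≤ c / (4 * (K + 1)) * V + (2 * (K + 1)) / (c * C₁) * (lam ^ 2 * d ^ 2 / κ ^ 2) := by
      intro k hk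
      have hkj := Finset.ne_of_mem_erase hk
      have hkK := hmem (Finset.mem_of_mem_erase hk)
      have e1 := Real.sq_sqrt (hn k hkK)
      have e2 := hsmall k hkK hkj
      have e3 : lam * u * Real.sqrt (n k) ≤ lam * d * Real.sqrt (n k) := by gcongr
      set e := c / (4 * (K + 1 : ℝ)) with he
      have he0 : 0 < e := by positivity
      have e4 : 0 ≤ (e * C₁ * κ ^ 2 * Real.sqrt (n k) - lam * d) ^ 2 / (2 * e * C₁ * κ ^ 2) := by
        positivity
      have e5 : (e * C₁ * κ ^ 2 * Real.sqrt (n k) - lam * d) ^ 2 / (2 * e * C₁ * κ ^ 2)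
          = e * (C₁ * Real.sqrt (n k) ^ 2 * κ ^ 2 / 2) + 1 / (2 * e * C₁) * (lam ^ 2 * d ^ 2 / κ ^ 2)
            - lam * d * Real.sqrt (n k) := by
        field_simp
        ring
      have e6 : 1 / (2 * e * C₁) = (2 * (K + 1)) / (c * C₁) := by
        rw [he]; field_simp; ring
      rw [e1, e6] at e5
      have e7 := mul_le_mul_of_nonneg_left e2 he0.le
      linarith
    refine (Finset.sum_le_sum this).trans ?_
    rw [Finset.sum_const, nsmul_eq_mul]
    have hcard : (((Finset.range (K + 1)).erase j₀).card : ℝ) ≤ K + 1 := by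
      have := Finset.card_erase_le (s := Finset.range (K + 1)) (a := j₀)
      rw [Finset.card_range] at this
      exact_mod_cast this
    refine (mul_le_mul_of_nonneg_right hcard hQ).trans (le_of_eq ?_)
    field_simp
  have h4 : ∑ k ∈ Finset.range (K + 1), lam * Real.sqrt (n k) * a k
      + lam₀ * ∑ k ∈ Finset.range (K + 1), Real.sqrt (n k) * l k
      ≤ ∑ k ∈ Finset.range (K + 1), 2 * (lam * Real.sqrt (n k) * (Real.sqrt d * δ k))
        + ∑ k ∈ Finset.range (K + 1), lam₀ * (Real.sqrt (n k) * w)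
        + ∑ k ∈ Finset.range (K + 1), lam * u * Real.sqrt (n k) := by
    rw [Finset.mul_sum, ← Finset.sum_add_distrib, ← Finset.sum_add_distrib,
      ← Finset.sum_add_distrib]
    refine Finset.sum_le_sum fun k hk => ?_
    have e1 := mul_le_mul_of_nonneg_left (ha k (hmem hk))
      (mul_nonneg hlamn (Real.sqrt_nonneg (n k)))
    have e2 := mul_le_mul_of_nonneg_left (hl k (hmem hk))
      (mul_nonneg hlam₀ (Real.sqrt_nonneg (n k)))
    have e3 : lam₀ * Real.sqrt (n k) * (Real.sqrt d * δ k)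
        ≤ lam * Real.sqrt (n k) * (Real.sqrt d * δ k) := by
      have := hδ k (hmem hk)
      gcongr
    nlinarith
  have h5 : lam * Real.sqrt N * (u + w) = lam * u * Real.sqrt N + lam * Real.sqrt N * w := by ring
  linarith

/-- The number of times of `{a, …, b - 1}` in the `k`-th interval of `P`. -/
def IntervalPartition.overlap {T : ℕ} (P : IntervalPartition T) (a b k : ℕ) : ℕ :=
  min b (P.η (k + 1)) - max a (P.η k)

/-- The squared distance, summed over the times of `{a, …, b - 1}`, of the matrix `A` from the
matrices `B k` in force on the intervals of `P`. -/
noncomputable def signal {T : ℕ} (P : IntervalPartition T) (B : ℕ → Matrix (Fin M) (Fin M) ℝ)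
    (A : Matrix (Fin M) (Fin M) ℝ) (a b : ℕ) : ℝ :=
  ∑ k ∈ Finset.range (P.K + 1), (P.overlap a b k : ℝ) * frobNorm (A - B k) ^ 2

section

variable {T : ℕ} {P : IntervalPartition T} {B : ℕ → Matrix (Fin M) (Fin M) ℝ} {κ C₁ : ℝ}

theorem signal_nonneg (A : Matrix (Fin M) (Fin M) ℝ) (a b : ℕ) : 0 ≤ signal P B A a b :=
  Finset.sum_nonneg fun _ _ => by positivity

/-- A matrix cannot be close to both sides of a jump. -/
theorem min_overlap_le_signal (hκ : 0 < κ)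
    (hjump : ∀ k < P.K, κ ≤ frobNorm (B (k + 1) - B k)) (A : Matrix (Fin M) (Fin M) ℝ)
    (a b : ℕ) {i : ℕ} (hi : i < P.K) :
    min (P.overlap a b i : ℝ) (P.overlap a b (i + 1)) * κ ^ 2 / 2 ≤ signal P B A a b := by
  have h1 : (P.overlap a b i : ℝ) * frobNorm (A - B i) ^ 2
      + (P.overlap a b (i + 1) : ℝ) * frobNorm (A - B (i + 1)) ^ 2 ≤ signal P B A a b := by
    unfold signal
    rw [← Finset.sum_pair (f := fun k => (P.overlap a b k : ℝ) * frobNorm (A - B k) ^ 2)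
      (show i ≠ i + 1 by omega)]
    refine Finset.sum_le_sum_of_subset_of_nonneg ?_ fun _ _ _ => by positivity
    intro k hk
    simp only [Finset.mem_insert, Finset.mem_singleton] at hk
    exact Finset.mem_range.mpr (by omega)
  have h2 := frobNorm_sub_sq_le A (B (i + 1)) (B i)
  have h3 : κ ^ 2 ≤ frobNorm (B (i + 1) - B i) ^ 2 := pow_le_pow_left₀ hκ.le (hjump i hi) 2
  set m := min (P.overlap a b i : ℝ) (P.overlap a b (i + 1))
  have hm0 : 0 ≤ m := le_min (Nat.cast_nonneg _) (Nat.cast_nonneg _)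
  have h4 : m * frobNorm (A - B i) ^ 2 ≤ (P.overlap a b i : ℝ) * frobNorm (A - B i) ^ 2 :=
    mul_le_mul_of_nonneg_right (min_le_left _ _) (sq_nonneg _)
  have h5 : m * frobNorm (A - B (i + 1)) ^ 2
      ≤ (P.overlap a b (i + 1) : ℝ) * frobNorm (A - B (i + 1)) ^ 2 :=
    mul_le_mul_of_nonneg_right (min_le_right _ _) (sq_nonneg _)
  have h6 := mul_le_mul_of_nonneg_left (h3.trans h2) hm0
  linarith

/-- Every piece of an interval other than a longest one is controlled by the signal: towards the
longest piece `j₀`, its neighbour is either `j₀` or a full interval of the partition, whose length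
is a fixed proportion of `T`. -/
theorem overlap_le_signal (hκ : 0 < κ) (hC₁ : 0 < C₁)
    (hjump : ∀ k < P.K, κ ≤ frobNorm (B (k + 1) - B k))
    (hΔ : C₁ * (T : ℝ) ≤ P.minSpacing) (A : Matrix (Fin M) (Fin M) ℝ) {a b : ℕ} (ha : 1 ≤ a)
    (hb : b ≤ T + 1) {j₀ : ℕ} (hj₀ : j₀ ≤ P.K)
    (hmax : ∀ k ≤ P.K, P.overlap a b k ≤ P.overlap a b j₀) {k : ℕ} (hk : k ≤ P.K)
    (hne : k ≠ j₀) :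
    C₁ * (P.overlap a b k : ℝ) * κ ^ 2 / 2 ≤ signal P B A a b := by
  have hC1 : C₁ ≤ 1 := by
    have h1 := P.mul_minSpacing_le
    have h2 : P.minSpacing ≤ T := by nlinarith [Nat.zero_le (P.K * P.minSpacing)]
    have hT : (0 : ℝ) < T := by
      have h3 := P.η_strictMono (Nat.succ_pos P.K) le_rfl
      rw [P.first, P.last] at h3
      exact_mod_cast (by omega : 0 < T)
    have h3 : (P.minSpacing : ℝ) ≤ T := by exact_mod_cast h2
    by_contra h4
    nlinarith
  rcases Nat.eq_zero_or_pos (P.overlap a b k) with h0 | hpos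
  · rw [h0]
    simpa using signal_nonneg A a b
  have hpos' := hpos.trans_le (hmax k hk)
  have hkT : P.overlap a b k ≤ T := by unfold IntervalPartition.overlap; omega
  have hkT' : (P.overlap a b k : ℝ) ≤ T := by exact_mod_cast hkT
  -- a piece strictly between two nonempty pieces is a full interval of the partition
  have hfull : ∀ i, (k < i ∧ i < j₀ ∨ j₀ < i ∧ i < k) → P.minSpacing ≤ P.overlap a b i := by
    intro i hi
    have h1 := P.minSpacing_le (i := i) (by omega)
    unfold IntervalPartition.overlap at hpos hpos' ⊢
    rcases hi with hi | hi
    · have h2 := P.η_mono (i := k + 1) (j := i) (by omega) (by omega)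
      have h3 := P.η_mono (i := i + 1) (j := j₀) (by omega) (by omega)
      omega
    · have h2 := P.η_mono (i := j₀ + 1) (j := i) (by omega) (by omega)
      have h3 := P.η_mono (i := i + 1) (j := k) (by omega) (by omega)
      omega
  have hfin : ∀ x : ℝ, C₁ * (P.overlap a b k : ℝ) ≤ x → x * κ ^ 2 / 2 ≤ signal P B A a b →
      C₁ * (P.overlap a b k : ℝ) * κ ^ 2 / 2 ≤ signal P B A a b := by
    intro x h1 h2
    refine le_trans ?_ h2
    gcongr
  have hC1k : C₁ * (P.overlap a b k : ℝ) ≤ P.overlap a b k :=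
    mul_le_of_le_one_left (Nat.cast_nonneg _) hC1
  have hneigh : ∀ i, (i = j₀ ∨ (k < i ∧ i < j₀ ∨ j₀ < i ∧ i < k)) →
      C₁ * (P.overlap a b k : ℝ) ≤ P.overlap a b i := by
    rintro i (rfl | hi)
    · refine hC1k.trans ?_
      exact_mod_cast hmax k hk
    · refine (mul_le_mul_of_nonneg_left hkT' hC₁.le).trans (hΔ.trans ?_)
      exact_mod_cast hfull i hi
  rcases lt_or_gt_of_ne hne with h | h
  · exact hfin _ (le_min hC1k (hneigh (k + 1) (by omega)))
      (min_overlap_le_signal hκ hjump A a b (by omega))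
  · obtain ⟨i, rfl⟩ : ∃ i, k = i + 1 := ⟨k - 1, by omega⟩
    exact hfin _ (le_min (hneigh i (by omega)) hC1k)
      (min_overlap_le_signal hκ hjump A a b (by omega))

variable {S : Finset (Fin M × Fin M)} {ℓ : Matrix (Fin M) (Fin M) ℝ → ℕ → ℝ} {c lam lam₀ : ℝ}

/-- The excess loss of a matrix over the true one, on an interval on which the latter does not
change, is at least quadratic in their distance, up to a multiple of their `ℓ₁`-distance that is
small compared with the penalty. Here `ℓ A t` is the loss of `A` at time `t`, and `B k` the true
matrix on the `k`-th interval of `P`. -/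
def RestrictedConvexity {T : ℕ} (P : IntervalPartition T) (B : ℕ → Matrix (Fin M) (Fin M) ℝ)
    (ℓ : Matrix (Fin M) (Fin M) ℝ → ℕ → ℝ) (c lam₀ : ℝ) : Prop :=
  ∀ k ≤ P.K, ∀ a b, P.η k ≤ a → a ≤ b → b ≤ P.η (k + 1) → ∀ A ∈ rowBall M,
    c * ((b - a : ℕ) : ℝ) * frobNorm (A - B k) ^ 2
        - lam₀ * Real.sqrt ((b - a : ℕ) : ℝ) * l1Norm (A - B k)
      ≤ ∑ t ∈ Finset.Ico a b, (ℓ A t - ℓ (B k) t)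

/-- The penalized loss of one matrix over an interval is at least the sum of the penalized losses
of the true matrices over its pieces plus a multiple of the signal, up to an error of the order of
the penalty `γ` of an additional change point. -/
theorem penalized_lower_bound (hκ : 0 < κ) (hC₁ : 0 < C₁) (hc : 0 < c) (hlam₀ : 0 ≤ lam₀)
    (hjump : ∀ k < P.K, κ ≤ frobNorm (B (k + 1) - B k))
    (hsupp : ∀ k ≤ P.K, ∀ m m', (m, m') ∉ S → B k m m' = 0)
    (hΔ : C₁ * (T : ℝ) ≤ P.minSpacing) (hlam : (P.K + 1) * lam₀ ≤ lam)
    (hconv : RestrictedConvexity P B ℓ c lam₀)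
    {A : Matrix (Fin M) (Fin M) ℝ} (hA : A ∈ rowBall M) {a b : ℕ} (ha : 1 ≤ a)
    (hb : b ≤ T + 1) :
    ∑ k ∈ Finset.range (P.K + 1),
        (∑ t ∈ Finset.Ico (max a (P.η k)) (min b (P.η (k + 1))), ℓ (B k) t
          + lam * Real.sqrt (P.overlap a b k) * l1Norm (B k))
        + c / 4 * signal P B A a b
      ≤ ∑ t ∈ Finset.Ico a b, ℓ A t + lam * Real.sqrt ((b - a : ℕ) : ℝ) * l1Norm A
        + ((P.K + 1) * (2 / c) * (lam ^ 2 * S.card)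
          + (P.K + 1) * ((2 * (P.K + 1)) / (c * C₁) * (lam ^ 2 * (S.card : ℝ) ^ 2 / κ ^ 2))) := by
  obtain ⟨j₀, hj₀, hmax⟩ := Finset.exists_max_image (Finset.range (P.K + 1)) (P.overlap a b)
    ⟨0, by simp⟩
  have hj₀' : j₀ ≤ P.K := by have := Finset.mem_range.mp hj₀; omega
  have hmax' : ∀ k ≤ P.K, P.overlap a b k ≤ P.overlap a b j₀ := fun k hk =>
    hmax k (Finset.mem_range.mpr (by omega))
  have h1 := penalty_absorption (K := P.K) (j₀ := j₀) (n := fun k => (P.overlap a b k : ℝ))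
    (δ := fun k => frobNorm (A - B k)) (a := fun k => l1Norm (B k))
    (l := fun k => l1Norm (A - B k)) (N := ((b - a : ℕ) : ℝ)) (c := c) (lam := lam)
    (lam₀ := lam₀) (d := S.card) (κ := κ) (C₁ := C₁) (u := l1On S A) (w := l1On Sᶜ A)
    (V := signal P B A a b) hj₀' (fun _ _ => Nat.cast_nonneg _)
    (fun k _ => by
      have : P.overlap a b k ≤ b - a := by unfold IntervalPartition.overlap; omega
      exact_mod_cast this)
    (fun _ _ => frobNorm_nonneg _) (fun k hk => l1Norm_le_add A (hsupp k hk))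
    (fun k hk => l1Norm_sub_le A (hsupp k hk)) (l1On_nonneg _ _) (l1On_le_card S hA)
    (l1On_nonneg _ _) hc hlam₀ hlam hκ hC₁ rfl
    (fun k hk hne => overlap_le_signal hκ hC₁ hjump hΔ A ha hb hj₀' hmax' hk hne)
  have h2 : ∀ k ∈ Finset.range (P.K + 1),
      c * ((P.overlap a b k : ℝ) * frobNorm (A - B k) ^ 2)
        - lam₀ * (Real.sqrt (P.overlap a b k) * l1Norm (A - B k))
      ≤ ∑ t ∈ Finset.Ico (max a (P.η k)) (min b (P.η (k + 1))), ℓ A t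
        - ∑ t ∈ Finset.Ico (max a (P.η k)) (min b (P.η (k + 1))), ℓ (B k) t := by
    intro k hk
    have hk' : k ≤ P.K := by have := Finset.mem_range.mp hk; omega
    rcases le_total (max a (P.η k)) (min b (P.η (k + 1))) with h | h
    · have h3 := hconv k hk' _ _ (le_max_right _ _) h (min_le_right _ _) A hA
      rw [Finset.sum_sub_distrib] at h3
      refine le_trans (le_of_eq ?_) h3
      unfold IntervalPartition.overlap
      ring
    · have h3 : P.overlap a b k = 0 := by unfold IntervalPartition.overlap; omega
      simp [h3, Finset.Ico_eq_empty_of_le h]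
  have h3 := Finset.sum_le_sum h2
  rw [Finset.sum_sub_distrib, Finset.sum_sub_distrib, ← Finset.mul_sum, ← Finset.mul_sum,
    P.sum_pieces ha hb] at h3
  rw [← l1Norm_eq] at h1
  rw [Finset.sum_add_distrib]
  unfold signal at h1 ⊢
  linarith

/-- A partition whose penalized loss does not exceed that of the true one has at most as many
change points, and little signal in its intervals. The matrices `Ahat k` are those fitted on the
intervals of `Q`; `W` bounds the error in `penalized_lower_bound`. -/
theorem signal_le_of_cost_le (hκ : 0 < κ) (hC₁ : 0 < C₁) (hc : 0 < c) (hlam₀ : 0 ≤ lam₀)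
    (hjump : ∀ k < P.K, κ ≤ frobNorm (B (k + 1) - B k))
    (hsupp : ∀ k ≤ P.K, ∀ m m', (m, m') ∉ S → B k m m' = 0)
    (hΔ : C₁ * (T : ℝ) ≤ P.minSpacing) (hlam : (P.K + 1) * lam₀ ≤ lam)
    (hconv : RestrictedConvexity P B ℓ c lam₀) {gam W : ℝ} (hW : 0 ≤ W)
    (hWerr : (P.K + 1) * (2 / c) * (lam ^ 2 * S.card)
      + (P.K + 1) * ((2 * (P.K + 1)) / (c * C₁) * (lam ^ 2 * (S.card : ℝ) ^ 2 / κ ^ 2)) ≤ W)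
    (hgam : (P.K + 2) * W < gam) {Q : IntervalPartition T}
    {Ahat : ℕ → Matrix (Fin M) (Fin M) ℝ} (hAhat : ∀ k ≤ Q.K, Ahat k ∈ rowBall M)
    (hcost : ∑ k ∈ Finset.range (Q.K + 1), (∑ t ∈ Finset.Ico (Q.η k) (Q.η (k + 1)), ℓ (Ahat k) t
          + lam * Real.sqrt ((Q.η (k + 1) - Q.η k : ℕ) : ℝ) * l1Norm (Ahat k)) + gam * (Q.K + 1)
      ≤ ∑ k ∈ Finset.range (P.K + 1), (∑ t ∈ Finset.Ico (P.η k) (P.η (k + 1)), ℓ (B k) t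
          + lam * Real.sqrt ((P.η (k + 1) - P.η k : ℕ) : ℝ) * l1Norm (B k)) + gam * (P.K + 1)) :
    Q.K ≤ P.K ∧ ∀ k ≤ Q.K,
      c / 4 * signal P B (Ahat k) (Q.η k) (Q.η (k + 1)) ≤ gam * (P.K + 1) := by
  have hlamn : 0 ≤ lam := le_trans (by positivity) hlam
  have h1 : ∀ k ∈ Finset.range (Q.K + 1), _ := fun k hk =>
    have hk' : k ≤ Q.K := by have := Finset.mem_range.mp hk; omega
    penalized_lower_bound hκ hC₁ hc hlam₀ hjump hsupp hΔ hlam hconv (hAhat k hk')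
      (Q.one_le_η (i := k) (by omega)) (Q.η_le_succ (i := k + 1) (by omega))
  have h2 := Finset.sum_le_sum h1
  rw [Finset.sum_add_distrib, Finset.sum_comm, Finset.sum_add_distrib (s := Finset.range (Q.K + 1)),
    Finset.sum_const, Finset.card_range, nsmul_eq_mul] at h2
  -- the losses and penalties over the common refinement of `P` and `Q` dominate those over `P`
  have h3 : ∑ j ∈ Finset.range (P.K + 1), (∑ t ∈ Finset.Ico (P.η j) (P.η (j + 1)), ℓ (B j) t
          + lam * Real.sqrt ((P.η (j + 1) - P.η j : ℕ) : ℝ) * l1Norm (B j))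
      ≤ ∑ j ∈ Finset.range (P.K + 1), ∑ k ∈ Finset.range (Q.K + 1),
        (∑ t ∈ Finset.Ico (max (Q.η k) (P.η j)) (min (Q.η (k + 1)) (P.η (j + 1))), ℓ (B j) t
          + lam * Real.sqrt (P.overlap (Q.η k) (Q.η (k + 1)) j) * l1Norm (B j)) := by
    refine Finset.sum_le_sum fun j hj => ?_
    have hj' : j ≤ P.K := by have := Finset.mem_range.mp hj; omega
    have ha := P.one_le_η (i := j) (by omega)
    have hb := P.η_le_succ (i := j + 1) (by omega)
    rw [Finset.sum_add_distrib]
    refine add_le_add (le_of_eq ?_) ?_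
    · rw [← Q.sum_pieces ha hb]
      refine Finset.sum_congr rfl fun k _ => ?_
      rw [max_comm, min_comm]
    · rw [← Finset.sum_mul, ← Finset.mul_sum]
      refine mul_le_mul_of_nonneg_right (mul_le_mul_of_nonneg_left ?_ hlamn) (l1Norm_nonneg _)
      have h4 := Q.sum_pieces ha hb (fun _ => 1)
      simp only [Finset.sum_const, Nat.card_Ico, nsmul_eq_mul, mul_one] at h4
      rw [← h4]
      refine (Real.sqrt_le_iff).mpr ⟨Finset.sum_nonneg fun _ _ => Real.sqrt_nonneg _, ?_⟩
      refine le_trans (le_of_eq ?_) (Finset.sum_sq_le_sq_sum_of_nonneg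
        fun _ _ => Real.sqrt_nonneg _)
      refine Finset.sum_congr rfl fun k _ => ?_
      rw [Real.sq_sqrt (Nat.cast_nonneg _), IntervalPartition.overlap, max_comm, min_comm]
  set E := (P.K + 1) * (2 / c) * (lam ^ 2 * S.card)
      + (P.K + 1) * ((2 * (P.K + 1)) / (c * C₁) * (lam ^ 2 * (S.card : ℝ) ^ 2 / κ ^ 2))
  push_cast at h2
  have h4 : ∑ k ∈ Finset.range (Q.K + 1),
      c / 4 * signal P B (Ahat k) (Q.η k) (Q.η (k + 1)) + gam * (Q.K + 1)
      ≤ (Q.K + 1) * W + gam * (P.K + 1) := by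
    have : (Q.K + 1 : ℝ) * E ≤ (Q.K + 1) * W := by gcongr
    linarith
  have h5 : ∀ k ∈ Finset.range (Q.K + 1),
      0 ≤ c / 4 * signal P B (Ahat k) (Q.η k) (Q.η (k + 1)) := fun k _ =>
    mul_nonneg (by positivity) (signal_nonneg _ _ _)
  have hWgam : W ≤ gam := by
    have : (0 : ℝ) ≤ P.K := Nat.cast_nonneg _
    nlinarith
  refine ⟨?_, fun k hk => ?_⟩
  · by_contra hcon
    have h6 : (P.K : ℝ) + 1 ≤ Q.K := by exact_mod_cast not_le.mp hcon
    have h7 := Finset.sum_nonneg h5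
    have h8 : ((P.K : ℝ) + 2) * (gam - W) ≤ (Q.K + 1) * (gam - W) := by
      refine mul_le_mul_of_nonneg_right (by linarith) (by linarith)
    nlinarith
  · have h6 := Finset.single_le_sum h5 (Finset.mem_range.mpr (Nat.lt_succ_of_le hk))
    have h7 : (0 : ℝ) ≤ (Q.K + 1) * (gam - W) := by
      have : 0 ≤ gam - W := by linarith
      positivity
    nlinarith

/-- If the signal of a jump within the intervals of `Q` is small, every change point of `P` is
close to one of `Q`. -/
theorem exists_close (hκ : 0 < κ) (hc : 0 < c)
    (hjump : ∀ k < P.K, κ ≤ frobNorm (B (k + 1) - B k)) {Q : IntervalPartition T}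
    {Ahat : ℕ → Matrix (Fin M) (Fin M) ℝ} {G ε : ℝ}
    (hsig : ∀ k ≤ Q.K, c / 4 * signal P B (Ahat k) (Q.η k) (Q.η (k + 1)) ≤ G)
    (hε : 8 * G / (c * κ ^ 2) ≤ ε) (hεΔ : ε < P.minSpacing) {i : ℕ} (h1 : 1 ≤ i)
    (hi : i ≤ P.K) :
    ∃ k, 1 ≤ k ∧ k ≤ Q.K ∧ |(Q.η k : ℝ) - P.η i| ≤ ε := by
  obtain ⟨j, rfl⟩ : ∃ j, i = j + 1 := ⟨i - 1, by omega⟩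
  have hT := P.η_strictMono (i := j + 1) (j := P.K + 1) (by omega) le_rfl
  rw [P.last] at hT
  obtain ⟨k, hk, hk1, hk2⟩ := Q.exists_mem (P.one_le_η (i := j + 1) (by omega)) (by omega)
  have h2 := min_overlap_le_signal hκ hjump (Ahat k) (Q.η k) (Q.η (k + 1)) (i := j) (by omega)
  have h3 : min (P.overlap (Q.η k) (Q.η (k + 1)) j : ℝ)
      (P.overlap (Q.η k) (Q.η (k + 1)) (j + 1)) ≤ ε := by
    refine le_trans ?_ hε
    rw [le_div_iff₀ (by positivity)]
    have h4 := hsig k hk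
    have h5 := mul_le_mul_of_nonneg_left h2 (show 0 ≤ c / 4 by positivity)
    nlinarith
  have ha := P.add_minSpacing_le (i := j) (j := j + 1) (by omega) (by omega)
  have hb := P.add_minSpacing_le (i := j + 1) (j := j + 2) (by omega) (by omega)
  -- a piece as short as `ε` is cut off by an end point of the interval of `Q`
  rcases min_le_iff.mp h3 with h | h
  · have h4 : P.overlap (Q.η k) (Q.η (k + 1)) j = P.η (j + 1) - max (Q.η k) (P.η j) := by
      unfold IntervalPartition.overlap
      rw [min_eq_right hk2.le]
    have h5 : P.overlap (Q.η k) (Q.η (k + 1)) j < P.minSpacing := by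
      exact_mod_cast h.trans_lt hεΔ
    have h6 : P.overlap (Q.η k) (Q.η (k + 1)) j + Q.η k = P.η (j + 1) := by omega
    have h6' : (P.overlap (Q.η k) (Q.η (k + 1)) j : ℝ) + Q.η k = P.η (j + 1) := by
      exact_mod_cast h6
    have hlt : P.η j < Q.η k := by omega
    refine ⟨k, ?_, hk, ?_⟩
    · by_contra hcon
      have hk0 : k = 0 := by omega
      have h7 := P.one_le_η (i := j) (by omega)
      rw [hk0, Q.first] at hlt
      omega
    · rw [abs_sub_comm, ← h6', add_sub_cancel_right, abs_of_nonneg (Nat.cast_nonneg _)]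
      exact h
  · have h4 : P.overlap (Q.η k) (Q.η (k + 1)) (j + 1)
        = min (Q.η (k + 1)) (P.η (j + 2)) - P.η (j + 1) := by
      unfold IntervalPartition.overlap
      rw [max_eq_right hk1]
    have h5 : P.overlap (Q.η k) (Q.η (k + 1)) (j + 1) < P.minSpacing := by
      exact_mod_cast h.trans_lt hεΔ
    have h6 : P.overlap (Q.η k) (Q.η (k + 1)) (j + 1) + P.η (j + 1) = Q.η (k + 1) := by omega
    have h6' : (P.overlap (Q.η k) (Q.η (k + 1)) (j + 1) : ℝ) + P.η (j + 1) = Q.η (k + 1) := by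
      exact_mod_cast h6
    have hlt : Q.η (k + 1) < P.η (j + 2) := by omega
    refine ⟨k + 1, by omega, ?_, ?_⟩
    · by_contra hcon
      have hk0 : k = Q.K := by omega
      have h7 := P.η_le_succ (i := j + 2) (by omega)
      rw [hk0, Q.last] at hlt
      omega
    · rw [← h6', add_sub_cancel_right, abs_of_nonneg (Nat.cast_nonneg _)]
      exact h

end

/-! ### Restricted convexity of the likelihood -/

theorem exp_sub_one_sub_ge {L x : ℝ} (hx : |x| ≤ L) :
    1 / (4 * (1 + L)) * x ^ 2 ≤ Real.exp x - 1 - x := by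
  have hL : 0 ≤ L := (abs_nonneg x).trans hx
  have hx' := abs_le.mp hx
  rw [one_div_mul_eq_div, div_le_iff₀ (by positivity)]
  rcases le_or_gt (-2) x with h | h
  · have h1 : (1 + x / 2) ^ 2 ≤ Real.exp (x / 2) ^ 2 := by
      refine pow_le_pow_left₀ (by linarith) ?_ 2
      linarith [Real.add_one_le_exp (x / 2)]
    rw [← Real.exp_nat_mul] at h1
    have h2 : ((2 : ℕ) : ℝ) * (x / 2) = x := by push_cast; ring
    rw [h2] at h1
    nlinarith [sq_nonneg x]
  · have h1 := Real.exp_pos x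
    nlinarith

/-- The strong convexity of the Poisson negative log-likelihood `z ↦ exp z - x * z` over bounded
log-intensities. -/
theorem poisson_loss_sub_ge {C y z x : ℝ} (hz : |z| ≤ C) (hyz : |y - z| ≤ C) :
    Real.exp (-C) / (4 * (1 + C)) * (y - z) ^ 2 - (x - Real.exp z) * (y - z)
      ≤ (Real.exp y - x * y) - (Real.exp z - x * z) := by
  have h1 := exp_sub_one_sub_ge hyz
  have h2 : Real.exp (-C) ≤ Real.exp z := Real.exp_le_exp.mpr (neg_le_of_abs_le hz)
  have h3 : Real.exp y = Real.exp z * Real.exp (y - z) := by rw [← Real.exp_add]; ring_nf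
  have hC : 0 ≤ C := (abs_nonneg z).trans hz
  have h4 : 0 ≤ 1 / (4 * (1 + C)) * (y - z) ^ 2 := by positivity
  have h5 : Real.exp (-C) * (1 / (4 * (1 + C)) * (y - z) ^ 2)
      ≤ Real.exp z * (Real.exp (y - z) - 1 - (y - z)) := by
    refine mul_le_mul h2 h1 h4 (Real.exp_pos z).le
  have h6 : Real.exp (-C) / (4 * (1 + C)) * (y - z) ^ 2
      = Real.exp (-C) * (1 / (4 * (1 + C)) * (y - z) ^ 2) := by ring
  rw [h6, h3]
  linarith

/-- The negative log-likelihood of the transition `t → t + 1`, which is observed if `t < T`. -/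
noncomputable def stepLoss (T : ℕ) (v : ℝ) (g : Features M) (x : ℕ → Fin M → ℤ)
    (A : Matrix (Fin M) (Fin M) ℝ) (t : ℕ) : ℝ :=
  if t < T then ∑ m, (Real.exp (logIntensity v g A (history x t) m)
        - (x (t + 1) m : ℝ) * logIntensity v g A (history x t) m) else 0

theorem penLoss_eq (T : ℕ) (v : ℝ) (g : Features M) (lam : ℝ) (x : ℕ → Fin M → ℤ)
    (A : Matrix (Fin M) (Fin M) ℝ) {a b : ℕ} (hab : a < b) :
    penLoss T v g lam x A a (b - 1) = ∑ t ∈ Finset.Ico a b, stepLoss T v g x A t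
      + lam * Real.sqrt ((b - a : ℕ) : ℝ) * l1Norm A := by
  unfold penLoss stepLoss
  have h : Finset.Icc a (b - 1) = Finset.Ico a b := by
    ext t; simp only [Finset.mem_Icc, Finset.mem_Ico]; omega
  rw [h, Finset.sum_filter, Nat.card_Ico]

theorem abs_sum_mul_le {C : ℝ} {r y : Fin M → ℝ} (hr : ∑ j, |r j| ≤ 1) (hy : ∀ j, |y j| ≤ C)
    (hC : 0 ≤ C) : |∑ j, r j * y j| ≤ C := by
  refine (Finset.abs_sum_le_sum_abs _ _).trans ?_
  have h1 : ∀ j ∈ Finset.univ, |r j * y j| ≤ |r j| * C := fun j _ => by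
    rw [abs_mul]; exact mul_le_mul_of_nonneg_left (hy j) (abs_nonneg _)
  refine (Finset.sum_le_sum h1).trans ?_
  rw [← Finset.sum_mul]
  exact mul_le_of_le_one_left hC hr

theorem rowSum_sub_le {A B : Matrix (Fin M) (Fin M) ℝ} (hA : A ∈ rowBall M) (hB : B ∈ rowBall M)
    (m : Fin M) : ∑ j, |(A - B) m j| ≤ 2 := by
  have h1 : ∑ j, |(A - B) m j| ≤ ∑ j, (|A m j| + |B m j|) :=
    Finset.sum_le_sum fun j _ => by rw [Matrix.sub_apply]; exact abs_sub _ _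
  rw [Finset.sum_add_distrib] at h1
  linarith [hA m, hB m]

theorem sum_rowSum_sq_le {D : Matrix (Fin M) (Fin M) ℝ} (hD : ∀ m, ∑ j, |D m j| ≤ 2) :
    ∑ m, (∑ j, |D m j|) ^ 2 ≤ 2 * l1Norm D := by
  unfold l1Norm
  rw [Finset.mul_sum]
  refine Finset.sum_le_sum fun m _ => ?_
  have h0 : 0 ≤ ∑ j, |D m j| := Finset.sum_nonneg fun _ _ => abs_nonneg _
  nlinarith [hD m]

theorem frobNorm_sq_le {D : Matrix (Fin M) (Fin M) ℝ} (hD : ∀ m, ∑ j, |D m j| ≤ 2) :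
    frobNorm D ^ 2 ≤ 2 * l1Norm D := by
  refine le_trans ?_ (sum_rowSum_sq_le hD)
  rw [frobNorm_sq]
  refine Finset.sum_le_sum fun m _ => ?_
  simp only [← sq_abs (D m _)]
  exact Finset.sum_sq_le_sq_sum_of_nonneg fun _ _ => abs_nonneg _

/-- A lower bound for a sum of quadratic forms `(r ⬝ y t)²` from one for their conditional
expectations `Y t`, in terms of the entrywise deviation. -/
theorem sum_quadratic_ge {s : Finset ℕ} {y : ℕ → Fin M → ℝ} {Y : ℕ → Matrix (Fin M) (Fin M) ℝ}
    {ω e : ℝ} {r : Fin M → ℝ}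
    (hY : ∀ t ∈ s, ω * ∑ i, r i ^ 2 ≤ ∑ i, ∑ j, r i * r j * Y t i j)
    (he : ∀ i j, |∑ t ∈ s, (y t i * y t j - Y t i j)| ≤ e) :
    ω * s.card * ∑ i, r i ^ 2 - e * (∑ i, |r i|) ^ 2 ≤ ∑ t ∈ s, (∑ i, r i * y t i) ^ 2 := by
  have h1 : ∀ t, (∑ i, r i * y t i) ^ 2 = ∑ i, ∑ j, r i * r j * (y t i * y t j - Y t i j)
      + ∑ i, ∑ j, r i * r j * Y t i j := by
    intro t
    rw [sq, Finset.sum_mul_sum]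
    simp only [← Finset.sum_add_distrib]
    refine Finset.sum_congr rfl fun i _ => Finset.sum_congr rfl fun j _ => ?_
    ring
  have h2 : ω * s.card * ∑ i, r i ^ 2 ≤ ∑ t ∈ s, ∑ i, ∑ j, r i * r j * Y t i j := by
    refine le_trans (le_of_eq ?_) (Finset.sum_le_sum hY)
    rw [Finset.sum_const, nsmul_eq_mul]
    ring
  have h3 : |∑ t ∈ s, ∑ i, ∑ j, r i * r j * (y t i * y t j - Y t i j)|
      ≤ e * (∑ i, |r i|) ^ 2 := by
    rw [Finset.sum_comm]
    simp_rw [Finset.sum_comm (s := s)]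
    rw [sq, Finset.sum_mul_sum, Finset.mul_sum]
    refine (Finset.abs_sum_le_sum_abs _ _).trans (Finset.sum_le_sum fun i _ => ?_)
    rw [Finset.mul_sum]
    refine (Finset.abs_sum_le_sum_abs _ _).trans (Finset.sum_le_sum fun j _ => ?_)
    rw [← Finset.mul_sum, abs_mul, abs_mul]
    have := he i j
    have h0 : 0 ≤ |r i| * |r j| := by positivity
    nlinarith
  simp_rw [h1, Finset.sum_add_distrib]
  linarith [neg_le_of_abs_le h3]

/-- The event on which the estimator succeeds, as a property of the path `x`: over every time
interval, the sums of the products of the innovations `x(t + 1) - E[X(t + 1) | x(1), …, x(t)]` with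
the features are small, and so are the entries of the sums of `g_t g_tᵀ - Y t`, where the
eigenvalues of the matrices `Y t` are at least `ω`. The length of an interval enters through its
square root. -/
structure GoodPath (T : ℕ) (v : ℝ) (g : Features M) (A : ℕ → Matrix (Fin M) (Fin M) ℝ)
    (p : ℕ) (ω a₁ a₂ : ℝ) (x : ℕ → Fin M → ℤ) (Y : ℕ → Matrix (Fin M) (Fin M) ℝ) : Prop where
  innovation : ∀ a b, 1 ≤ a → a ≤ b → b ≤ T → ∀ m j,
    |∑ t ∈ Finset.Ico a b, ((x (t + 1) m : ℝ) - Real.exp (logIntensity v g (A t) (history x t) m))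
      * feature g (history x t) j| ≤ a₁ * Real.sqrt ((b - a : ℕ) : ℝ)
  eigenvalue : ∀ t, p < t → t < T → ∀ r : Fin M → ℝ,
    ω * ∑ i, r i ^ 2 ≤ ∑ i, ∑ j, r i * r j * Y t i j
  gram : ∀ a b, p < a → a ≤ b → b ≤ T → ∀ i j,
    |∑ t ∈ Finset.Ico a b, (feature g (history x t) i * feature g (history x t) j - Y t i j)|
      ≤ a₂ * Real.sqrt ((b - a : ℕ) : ℝ)

theorem abs_feature_le {T : ℕ} {v : ℝ} {g : Features M} {Cg : ℝ} (hg : BoundedFeatures T v g Cg)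
    {t : ℕ} (h1 : 1 ≤ t) (hT : t < T) (h : Matrix (Fin M) (Fin t) ℤ) (m : Fin M) :
    |feature g h m| ≤ Cg := hg.2 t h1 hT _ m

theorem abs_logIntensity_le {T : ℕ} {v : ℝ} {g : Features M} {Cg : ℝ}
    (hg : BoundedFeatures T v g Cg) (hCg : 0 ≤ Cg) {A : Matrix (Fin M) (Fin M) ℝ}
    (hA : A ∈ rowBall M) {t : ℕ} (h1 : 1 ≤ t) (hT : t < T) (h : Matrix (Fin M) (Fin t) ℤ)
    (m : Fin M) : |logIntensity v g A h m| ≤ 2 * Cg := by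
  unfold logIntensity
  refine (abs_add_le _ _).trans ?_
  have h2 := abs_sum_mul_le (hA m) (fun j => abs_feature_le hg h1 hT h j) hCg
  linarith [hg.1]

/-- On a good path the excess loss is restricted strongly convex. The rows of the difference of two
matrices in the ball have `ℓ₁`-norm at most `2`, so that the error terms that are quadratic in the
difference are also of the order of its `ℓ₁`-norm. -/
theorem GoodPath.restrictedConvexity {T : ℕ} {v : ℝ} {g : Features M}
    {A : ℕ → Matrix (Fin M) (Fin M) ℝ} {p : ℕ} {ω a₁ a₂ Cg : ℝ} {x : ℕ → Fin M → ℤ}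
    {Y : ℕ → Matrix (Fin M) (Fin M) ℝ} (hx : GoodPath T v g A p ω a₁ a₂ x Y)
    (hω : 0 ≤ ω) (ha₁ : 0 ≤ a₁) (ha₂ : 0 ≤ a₂) (hCg : 0 ≤ Cg) (hg : BoundedFeatures T v g Cg)
    {P : IntervalPartition T} {B : ℕ → Matrix (Fin M) (Fin M) ℝ}
    (hB : ∀ k ≤ P.K, B k ∈ rowBall M)
    (hAB : ∀ k ≤ P.K, ∀ t, P.η k ≤ t → t < P.η (k + 1) → A t = B k) {c c' : ℝ}
    (hc' : c' = Real.exp (-(2 * Cg)) / (4 * (1 + 2 * Cg))) (hc : c = c' * ω) :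
    RestrictedConvexity P B (stepLoss T v g x) c (a₁ + 2 * c' * a₂ + 2 * c * (p + 1)) := by
  intro k hk a b ha hab hb D hD
  have hc'0 : 0 < c' := by rw [hc']; positivity
  have hc0 : 0 ≤ c := by rw [hc]; positivity
  rcases hab.eq_or_lt with rfl | hlt
  · simp
  have ha1 : 1 ≤ a := (P.one_le_η (i := k) (by omega)).trans ha
  have hbT : b ≤ T + 1 := hb.trans (P.η_le_succ (i := k + 1) (by omega))
  have hrow := rowSum_sub_le hD (hB k hk)
  set E := D - B k with hE
  set b' := min b T with hb'
  have hab' : a ≤ b' := by omega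
  -- the last time carries no transition
  have hsum : ∑ t ∈ Finset.Ico a b, (stepLoss T v g x D t - stepLoss T v g x (B k) t)
      = ∑ t ∈ Finset.Ico a b', (stepLoss T v g x D t - stepLoss T v g x (B k) t) := by
    symm
    refine Finset.sum_subset (Finset.Ico_subset_Ico_right (min_le_left _ _)) fun t ht ht' => ?_
    simp only [Finset.mem_Ico] at ht ht'
    have : ¬ t < T := by omega
    simp [stepLoss, this]
  -- convexity of each summand
  have hstep : ∀ t ∈ Finset.Ico a b',
      c' * ∑ m, (∑ j, E m j * feature g (history x t) j) ^ 2
        - ∑ m, ∑ j, E m j * (((x (t + 1) m : ℝ)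
          - Real.exp (logIntensity v g (A t) (history x t) m)) * feature g (history x t) j)
      ≤ stepLoss T v g x D t - stepLoss T v g x (B k) t := by
    intro t ht
    have ht' := Finset.mem_Ico.mp ht
    have htT : t < T := by omega
    rw [hAB k hk t (by omega) (by omega), stepLoss, stepLoss, if_pos htT, if_pos htT,
      ← Finset.sum_sub_distrib, Finset.mul_sum, ← Finset.sum_sub_distrib]
    refine Finset.sum_le_sum fun m _ => ?_
    have h1 := abs_logIntensity_le hg hCg (hB k hk) (t := t) (by omega) htT (history x t) m
    have h2 : logIntensity v g D (history x t) m - logIntensity v g (B k) (history x t) m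
        = ∑ j, E m j * feature g (history x t) j := by
      unfold logIntensity
      rw [add_sub_add_left_eq_sub, ← Finset.sum_sub_distrib]
      refine Finset.sum_congr rfl fun j _ => ?_
      rw [hE, Matrix.sub_apply, sub_mul]
    have h3 : |logIntensity v g D (history x t) m - logIntensity v g (B k) (history x t) m|
        ≤ 2 * Cg := by
      unfold logIntensity
      rw [add_sub_add_left_eq_sub]
      have e1 := abs_sum_mul_le (hD m)
        (fun j => abs_feature_le hg (by omega) htT (history x t) j) hCg
      have e2 := abs_sum_mul_le (hB k hk m)
        (fun j => abs_feature_le hg (by omega) htT (history x t) j) hCg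
      refine (abs_sub _ _).trans ?_
      linarith
    have h4 := poisson_loss_sub_ge (x := (x (t + 1) m : ℝ)) h1 h3
    rw [← hc', h2] at h4
    refine le_trans (le_of_eq ?_) h4
    congr 1
    rw [Finset.mul_sum]
    refine Finset.sum_congr rfl fun j _ => ?_
    ring
  have hstep' := Finset.sum_le_sum hstep
  rw [Finset.sum_sub_distrib, ← Finset.mul_sum] at hstep'
  set N := Real.sqrt ((b - a : ℕ) : ℝ) with hN
  have hN1 : 1 ≤ N := by
    rw [hN, Real.one_le_sqrt]
    exact_mod_cast (by omega : 1 ≤ b - a)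
  -- the noise
  have hnoise : ∑ t ∈ Finset.Ico a b', ∑ m, ∑ j, E m j * (((x (t + 1) m : ℝ)
          - Real.exp (logIntensity v g (A t) (history x t) m)) * feature g (history x t) j)
      ≤ a₁ * N * l1Norm E := by
    rw [Finset.sum_comm]
    simp_rw [Finset.sum_comm (s := Finset.Ico a b')]
    unfold l1Norm
    rw [Finset.mul_sum]
    refine Finset.sum_le_sum fun m _ => ?_
    rw [Finset.mul_sum]
    refine Finset.sum_le_sum fun j _ => ?_
    rw [← Finset.mul_sum]
    have h1 := hx.innovation a b' ha1 hab' (min_le_right _ _) m j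
    have h2 : Real.sqrt ((b' - a : ℕ) : ℝ) ≤ N := by
      refine Real.sqrt_le_sqrt ?_
      exact_mod_cast (by omega : b' - a ≤ b - a)
    refine (le_abs_self _).trans ?_
    rw [abs_mul, mul_comm]
    refine mul_le_mul_of_nonneg_right (h1.trans ?_) (abs_nonneg _)
    gcongr
  -- the quadratic part
  set s := Finset.Ico (max a (p + 1)) b' with hs
  have hgram : ∀ i j, |∑ t ∈ s, (feature g (history x t) i * feature g (history x t) j - Y t i j)|
      ≤ a₂ * N := by
    intro i j
    rcases le_total (max a (p + 1)) b' with h | h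
    · have h1 := hx.gram (max a (p + 1)) b' (by omega) h (min_le_right _ _) i j
      refine h1.trans ?_
      refine mul_le_mul_of_nonneg_left (Real.sqrt_le_sqrt ?_) ha₂
      exact_mod_cast (by omega : b' - max a (p + 1) ≤ b - a)
    · rw [hs, Finset.Ico_eq_empty_of_le h]
      simp only [Finset.sum_empty, abs_zero]
      positivity
  have hquad : ∀ m, ω * s.card * ∑ i, E m i ^ 2 - a₂ * N * (∑ i, |E m i|) ^ 2
      ≤ ∑ t ∈ Finset.Ico a b', (∑ i, E m i * feature g (history x t) i) ^ 2 := by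
    intro m
    refine (sum_quadratic_ge (fun t ht => ?_) hgram).trans ?_
    · have := Finset.mem_Ico.mp ht
      exact hx.eigenvalue t (by omega) (by omega) _
    · refine Finset.sum_le_sum_of_subset_of_nonneg ?_ fun _ _ _ => sq_nonneg _
      exact Finset.Ico_subset_Ico_left (le_max_left _ _)
  have hquad' := Finset.sum_le_sum fun m (_ : m ∈ Finset.univ) => hquad m
  rw [Finset.sum_sub_distrib, ← Finset.mul_sum, ← Finset.mul_sum, ← frobNorm_sq,
    Finset.sum_comm] at hquad'
  have hcard : ((b - a : ℕ) : ℝ) - (p + 1) ≤ s.card := by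
    rw [hs, Nat.card_Ico, sub_le_iff_le_add]
    exact_mod_cast (by omega : b - a ≤ b' - max a (p + 1) + (p + 1))
  have hF := frobNorm_sq_le hrow
  have hR := sum_rowSum_sq_le hrow
  have hl1 := l1Norm_nonneg E
  have e1 : ω * (((b - a : ℕ) : ℝ) - (p + 1)) * frobNorm E ^ 2
      ≤ ω * s.card * frobNorm E ^ 2 := by gcongr
  have e2 : a₂ * N * ∑ m, (∑ i, |E m i|) ^ 2 ≤ a₂ * N * (2 * l1Norm E) := by gcongr
  have e3 : ω * (p + 1) * frobNorm E ^ 2 ≤ ω * (p + 1) * (N * (2 * l1Norm E)) := by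
    refine mul_le_mul_of_nonneg_left (hF.trans ?_) (by positivity)
    nlinarith
  have e4 : ω * ((b - a : ℕ) : ℝ) * frobNorm E ^ 2 - ω * (p + 1) * (N * (2 * l1Norm E))
      - a₂ * N * (2 * l1Norm E) ≤ _ := le_trans (by linarith) hquad'
  have e5 := mul_le_mul_of_nonneg_left e4 hc'0.le
  rw [hsum]
  refine le_trans ?_ hstep'
  rw [hc]
  nlinarith

/-! ### The estimator on a good path -/

theorem eq_of_mem_interval {T : ℕ} {A : ℕ → Matrix (Fin M) (Fin M) ℝ} {P : IntervalPartition T}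
    (hA : ∀ t, 2 ≤ t → t ≤ T → (A t ≠ A (t - 1) ↔ ∃ k, 1 ≤ k ∧ k ≤ P.K ∧ t = P.η k)) {k : ℕ}
    (hk : k ≤ P.K) {t : ℕ} (h1 : P.η k ≤ t) (h2 : t < P.η (k + 1)) : A t = A (P.η k) := by
  induction t, h1 using Nat.le_induction with
  | base => rfl
  | succ n hn ih =>
    have h3 := P.one_le_η (i := k) (by omega)
    have h4 := P.η_le_succ (i := k + 1) (by omega)
    rw [← ih (by omega)]
    by_contra hne
    obtain ⟨j, hj1, hjK, hj⟩ := (hA (n + 1) (by omega) (by omega)).mp hne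
    rcases lt_trichotomy j (k + 1) with h | h | h
    · have := P.η_mono (i := j) (j := k) (by omega) (by omega)
      omega
    · rw [h] at hj; omega
    · have := P.η_strictMono h (by omega)
      omega

/-- The minimizing property of the estimated partition, compared with the true partition and the
true matrices `B k`. -/
theorem IsPDPEstimate.cost_le {T : ℕ} {v : ℝ} {g : Features M} {lam gam : ℝ}
    {x : ℕ → Fin M → ℤ} {Q : IntervalPartition T} (hQ : IsPDPEstimate T v g lam gam x Q)
    (P : IntervalPartition T) {B : ℕ → Matrix (Fin M) (Fin M) ℝ}
    (hB : ∀ k ≤ P.K, B k ∈ rowBall M) :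
    ∃ Ahat : ℕ → Matrix (Fin M) (Fin M) ℝ, (∀ k ≤ Q.K, Ahat k ∈ rowBall M) ∧
      ∑ k ∈ Finset.range (Q.K + 1),
          (∑ t ∈ Finset.Ico (Q.η k) (Q.η (k + 1)), stepLoss T v g x (Ahat k) t
          + lam * Real.sqrt ((Q.η (k + 1) - Q.η k : ℕ) : ℝ) * l1Norm (Ahat k)) + gam * (Q.K + 1)
      ≤ ∑ k ∈ Finset.range (P.K + 1),
          (∑ t ∈ Finset.Ico (P.η k) (P.η (k + 1)), stepLoss T v g x (B k) t
          + lam * Real.sqrt ((P.η (k + 1) - P.η k : ℕ) : ℝ) * l1Norm (B k))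
          + gam * (P.K + 1) := by
  obtain ⟨Ahat, hA, hmin⟩ := hQ
  have hint : ∀ (R : IntervalPartition T) (k : ℕ), k ≤ R.K →
      1 ≤ R.η k ∧ R.η k < R.η (k + 1) ∧ R.η (k + 1) ≤ T + 1 := fun R k hk =>
    ⟨R.one_le_η (by omega), R.lt_succ k hk, R.η_le_succ (by omega)⟩
  refine ⟨fun k => Ahat (Q.η k) (Q.η (k + 1) - 1), fun k hk => ?_, ?_⟩
  · obtain ⟨h1, h2, h3⟩ := hint Q k hk
    exact (hA _ _ h1 (by omega) (by omega)).1
  · refine le_trans (le_of_eq ?_) ((hmin P).trans ?_)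
    · unfold partitionCost
      congr 1
      refine Finset.sum_congr rfl fun k hk => ?_
      have hk' := Finset.mem_range.mp hk
      rw [penLoss_eq _ _ _ _ _ _ (hint Q k (by omega)).2.1]
    · unfold partitionCost
      refine add_le_add (Finset.sum_le_sum fun k hk => ?_) le_rfl
      have hk' := Finset.mem_range.mp hk
      obtain ⟨h1, h2, h3⟩ := hint P k (by omega)
      rw [← penLoss_eq _ _ _ _ _ _ h2]
      exact (hA _ _ h1 (by omega) (by omega)).2 _ (hB k (by omega))

theorem localization_error_le {κ C₁ c r d Cgam Ceps : ℝ} {K : ℕ} (hκ : 0 < κ) (hC₁ : 0 < C₁)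
    (hc : 0 < c) (hCgam : 0 < Cgam) (hd : 1 ≤ d) (hK : (K : ℝ) + 1 ≤ 1 / C₁)
    (hCeps : Ceps = 16 * Cgam / (c * C₁)) :
    8 * (Cgam * r ^ 2 * d * (1 + d * κ ^ (-2 : ℤ)) * (K + 1)) / (c * κ ^ 2)
      ≤ Ceps * d ^ 2 * r ^ 2 * max (κ ^ (-2 : ℤ)) (κ ^ (-4 : ℤ)) := by
  have hk2 : κ ^ (-2 : ℤ) = 1 / κ ^ 2 := by rw [zpow_neg, one_div]; norm_cast
  have hk4 : κ ^ (-4 : ℤ) = (κ ^ (-2 : ℤ)) ^ 2 := by rw [← zpow_natCast, ← zpow_mul]; norm_num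
  have hk0 : 0 < κ ^ (-2 : ℤ) := by positivity
  have hCeps0 : 0 < Ceps := by rw [hCeps]; positivity
  set m := max (κ ^ (-2 : ℤ)) (κ ^ (-4 : ℤ)) with hm
  have h3 : d * κ ^ (-2 : ℤ) ≤ d ^ 2 * m :=
    mul_le_mul (le_self_pow₀ hd (by norm_num)) (le_max_left _ _) hk0.le (sq_nonneg d)
  have h4 : d ^ 2 * (κ ^ (-2 : ℤ)) ^ 2 ≤ d ^ 2 * m :=
    mul_le_mul_of_nonneg_left (hk4 ▸ le_max_right _ _) (sq_nonneg d)
  have h1 : 8 * (Cgam * r ^ 2 * d * (1 + d * κ ^ (-2 : ℤ)) * (K + 1)) / (c * κ ^ 2)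
      ≤ 8 * (Cgam * r ^ 2 * d * (1 + d * κ ^ (-2 : ℤ)) * (1 / C₁)) / (c * κ ^ 2) := by gcongr
  refine h1.trans ?_
  have h2 : 8 * (Cgam * r ^ 2 * d * (1 + d * κ ^ (-2 : ℤ)) * (1 / C₁)) / (c * κ ^ 2)
      = Ceps * r ^ 2 / 2 * (d * κ ^ (-2 : ℤ) + d ^ 2 * (κ ^ (-2 : ℤ)) ^ 2) := by
    rw [hCeps, hk2]
    field_simp
    ring
  rw [h2]
  have h5 := mul_le_mul_of_nonneg_left (add_le_add h3 h4)
    (show 0 ≤ Ceps * r ^ 2 / 2 by positivity)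
  refine h5.trans (le_of_eq ?_)
  ring

/-- On a good path the estimated change points are as many as the true ones, and close to them.
Here `c` is the constant of restricted convexity and `b * r` bounds its `ℓ₁` error, where `r`
stands for `log (T * M)`. -/
theorem GoodPath.estimate {T : ℕ} {v : ℝ} {g : Features M}
    {A : ℕ → Matrix (Fin M) (Fin M) ℝ} {p : ℕ} {ω a₁ a₂ Cg C₁ : ℝ} {x : ℕ → Fin M → ℤ}
    {Y : ℕ → Matrix (Fin M) (Fin M) ℝ} (hx : GoodPath T v g A p ω a₁ a₂ x Y)
    (hω : 0 < ω) (ha₁ : 0 ≤ a₁) (ha₂ : 0 ≤ a₂) (hCg : 0 ≤ Cg) (hC₁ : 0 < C₁)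
    (hg : BoundedFeatures T v g Cg) {P : IntervalPartition T}
    (hchange : ∀ t, 2 ≤ t → t ≤ T → (A t ≠ A (t - 1) ↔ ∃ k, 1 ≤ k ∧ k ≤ P.K ∧ t = P.η k))
    {κ : ℝ} (hκ : IsMinJump A P κ) {S : Finset (Fin M × Fin M)} (hS : S.Nonempty)
    (hsupp : SupportedOn T A S) (hball : ∀ t, 1 ≤ t → t ≤ T → A t ∈ rowBall M)
    (hΔ : C₁ * (T : ℝ) ≤ P.minSpacing)
    {c c' b r Clam Cgam Ceps : ℝ} (hr : 0 < r) (hb : 0 < b)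
    (hc' : c' = Real.exp (-(2 * Cg)) / (4 * (1 + 2 * Cg))) (hc : c = c' * ω)
    (hbr : a₁ + 2 * c' * a₂ + 2 * c * (p + 1) ≤ b * r)
    (hClam : Clam = b / C₁)
    (hCgam : Cgam = (1 / C₁ + 2) * (2 / (c * C₁ ^ 3)) * Clam ^ 2)
    (hCeps : Ceps = 16 * Cgam / (c * C₁))
    (hsep : 2 * (Ceps * (S.card : ℝ) ^ 2 * r ^ 2 * max (κ ^ (-2 : ℤ)) (κ ^ (-4 : ℤ)))
      < P.minSpacing)
    {Q : IntervalPartition T}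
    (hQ : IsPDPEstimate T v g (Clam * r)
      (Cgam * r ^ 2 * (S.card : ℝ) * (1 + (S.card : ℝ) * κ ^ (-2 : ℤ))) x Q) :
    Q.K = P.K ∧ ∀ k, 1 ≤ k → k ≤ P.K → |(Q.η k : ℝ) - (P.η k : ℝ)| ≤
      Ceps * (S.card : ℝ) ^ 2 * r ^ 2 * max (κ ^ (-2 : ℤ)) (κ ^ (-4 : ℤ)) := by
  have hκ0 := hκ.1
  have hc'0 : 0 < c' := by rw [hc']; positivity
  have hc0 : 0 < c := by rw [hc]; positivity
  have hd1 : (1 : ℝ) ≤ S.card := by exact_mod_cast hS.card_pos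
  set d := (S.card : ℝ) with hd
  have hClam0 : 0 < Clam := by rw [hClam]; positivity
  have hCgam0 : 0 < Cgam := by rw [hCgam]; positivity
  have hCeps0 : 0 < Ceps := by rw [hCeps]; positivity
  have hT : (0 : ℝ) < T := by
    have h := P.η_strictMono (Nat.succ_pos P.K) le_rfl
    rw [P.first, P.last] at h
    exact_mod_cast (by omega : 0 < T)
  -- the number of intervals is bounded
  have hKC : ((P.K : ℝ) + 1) ≤ 1 / C₁ := by
    rw [le_div_iff₀ hC₁]
    have h1 : ((P.K : ℝ) + 1) * P.minSpacing ≤ T := by exact_mod_cast P.mul_minSpacing_le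
    have h2 : ((P.K : ℝ) + 1) * (C₁ * T) ≤ ((P.K : ℝ) + 1) * P.minSpacing := by gcongr
    refine le_of_mul_le_mul_right ?_ hT
    linarith
  obtain ⟨R, hR⟩ : ∃ R, R = 1 / C₁ := ⟨_, rfl⟩
  rw [← hR] at hKC hCgam
  have hR0 : 0 < R := by rw [hR]; positivity
  have hK0 : (0 : ℝ) ≤ P.K := Nat.cast_nonneg _
  have hR1 : 1 ≤ R := by linarith
  set B : ℕ → Matrix (Fin M) (Fin M) ℝ := fun k => A (P.η k) with hBdef
  have hη : ∀ k ≤ P.K, 1 ≤ P.η k ∧ P.η k ≤ T := fun k hk => by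
    have h1 := P.η_strictMono (i := k) (j := P.K + 1) (by omega) le_rfl
    rw [P.last] at h1
    exact ⟨P.one_le_η (by omega), by omega⟩
  have hB : ∀ k ≤ P.K, B k ∈ rowBall M := fun k hk => hball _ (hη k hk).1 (hη k hk).2
  have hBs : ∀ k ≤ P.K, ∀ m m', (m, m') ∉ S → B k m m' = 0 := fun k hk =>
    hsupp _ (hη k hk).1 (hη k hk).2
  have hjump : ∀ k < P.K, κ ≤ frobNorm (B (k + 1) - B k) := fun k hk =>
    (hκ.2 (by omega)).2 ⟨k + 1, by omega, by omega, rfl⟩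
  have hconv := hx.restrictedConvexity hω.le ha₁ ha₂ hCg hg hB
    (fun k hk t h1 h2 => eq_of_mem_interval hchange hk h1 h2) hc' hc
  set lam₀ := a₁ + 2 * c' * a₂ + 2 * c * (p + 1) with hlam₀
  have hlam₀0 : 0 ≤ lam₀ := by positivity
  have hlam : (P.K + 1) * lam₀ ≤ Clam * r := by
    have h1 : (P.K + 1) * lam₀ ≤ R * (b * r) := by gcongr
    refine h1.trans (le_of_eq ?_)
    rw [hClam, hR]
    ring
  set k2 : ℝ := κ ^ (-2 : ℤ) with hk2
  have hk2' : k2 = 1 / κ ^ 2 := by rw [hk2, zpow_neg, one_div]; norm_cast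
  have hk20 : 0 < k2 := by rw [hk2']; positivity
  set W := 2 / (c * C₁ ^ 3) * ((Clam * r) ^ 2 * d * (1 + d * k2)) with hW
  have hW0 : 0 < W := by rw [hW]; positivity
  clear_value W lam₀
  have hgamW : Cgam * r ^ 2 * d * (1 + d * k2) = (R + 2) * W := by
    rw [hCgam, hW]
    ring
  have hWerr : (P.K + 1) * (2 / c) * ((Clam * r) ^ 2 * d)
      + (P.K + 1) * ((2 * (P.K + 1)) / (c * C₁) * ((Clam * r) ^ 2 * d ^ 2 / κ ^ 2)) ≤ W := by
    have h1 : (P.K + 1) * (2 / c) * ((Clam * r) ^ 2 * d)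
        ≤ R ^ 3 * (2 / c) * ((Clam * r) ^ 2 * d) := by
      have : (P.K : ℝ) + 1 ≤ R ^ 3 := hKC.trans (le_self_pow₀ hR1 (by norm_num))
      gcongr
    have h2 : (P.K + 1) * ((2 * (P.K + 1)) / (c * C₁) * ((Clam * r) ^ 2 * d ^ 2 / κ ^ 2))
        ≤ R * ((2 * R) / (c * C₁) * ((Clam * r) ^ 2 * d ^ 2 / κ ^ 2)) := by gcongr
    refine (add_le_add h1 h2).trans (le_of_eq ?_)
    rw [hW, hR, hk2']
    field_simp
  obtain ⟨Ahat, hAhat, hcost⟩ := hQ.cost_le P hB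
  rw [hgamW] at hcost
  obtain ⟨hQK, hsig⟩ := signal_le_of_cost_le hκ0 hC₁ hc0 hlam₀0 hjump hBs hΔ hlam hconv hW0.le
    hWerr (by nlinarith) hAhat hcost
  set ε := Ceps * d ^ 2 * r ^ 2 * max k2 (κ ^ (-4 : ℤ)) with hε
  have hmax0 : 0 < max k2 (κ ^ (-4 : ℤ)) := lt_max_of_lt_left hk20
  have hε0 : 0 < ε := by positivity
  have hεG : 8 * ((R + 2) * W * (P.K + 1)) / (c * κ ^ 2) ≤ ε := by
    rw [hε, ← hgamW, hk2]
    exact localization_error_le hκ0 hC₁ hc0 hCgam0 hd1 (by rwa [← hR]) hCeps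
  refine P.match_of_close Q hsep (fun i h1 h2 => ?_) hQK
  exact exists_close hκ0 hc0 hjump hsig hεG (by linarith) h1 h2

/-! ### Exponential moments and deviations -/

section

variable {Ω : Type*} [mΩ : MeasurableSpace Ω] {μ : Measure Ω}

/-- Chernoff's bound with the exponent `τ / √n`. -/
theorem measure_abs_gt_le {Z : Ω → ℝ} (hZ : AEMeasurable Z μ) {n : ℕ} (hn : 1 ≤ n) {τ V : ℝ}
    (hτ : 0 < τ)
    (hexp : ∀ θ : ℝ, |θ| ≤ τ →
      ∫⁻ w, ENNReal.ofReal (Real.exp (θ * Z w)) ∂μ ≤ ENNReal.ofReal (Real.exp (θ ^ 2 * V * n)))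
    (s : ℝ) :
    μ {w | s * Real.sqrt n < |Z w|} ≤ ENNReal.ofReal (2 * Real.exp (τ ^ 2 * V - τ * s)) := by
  have hn1 : (1 : ℝ) ≤ n := by exact_mod_cast hn
  set N := Real.sqrt n with hN
  have hN1 : 1 ≤ N := by rw [hN, Real.one_le_sqrt]; exact hn1
  have hN0 : 0 < N := by linarith
  have hNn : N ^ 2 = n := Real.sq_sqrt (by linarith)
  have key : ∀ θ : ℝ, |θ| = τ / N →
      μ {w | τ * s ≤ θ * Z w} ≤ ENNReal.ofReal (Real.exp (τ ^ 2 * V - τ * s)) := by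
    intro θ hθ
    have h1 := hexp θ (by rw [hθ]; exact div_le_self hτ.le hN1)
    have h2 : θ ^ 2 * V * n = τ ^ 2 * V := by
      rw [← sq_abs, hθ, ← hNn]
      field_simp
    rw [h2] at h1
    have h3 := meas_ge_le_lintegral_div (μ := μ)
      (f := fun w => ENNReal.ofReal (Real.exp (θ * Z w)))
      (ENNReal.measurable_ofReal.comp_aemeasurable
        (Real.measurable_exp.comp_aemeasurable (hZ.const_mul θ)))
      (ε := ENNReal.ofReal (Real.exp (τ * s))) (by simp [Real.exp_pos]) ENNReal.ofReal_ne_top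
    have h4 : {w | τ * s ≤ θ * Z w} ⊆ {w | ENNReal.ofReal (Real.exp (τ * s))
        ≤ ENNReal.ofReal (Real.exp (θ * Z w))} := fun w hw =>
      ENNReal.ofReal_le_ofReal (Real.exp_le_exp.mpr hw)
    refine (measure_mono h4).trans (h3.trans ?_)
    refine (ENNReal.div_le_div_right h1 _).trans ?_
    rw [← ENNReal.ofReal_div_of_pos (Real.exp_pos _), ← Real.exp_sub]
  have hsub : {w | s * N < |Z w|} ⊆ {w | τ * s ≤ τ / N * Z w} ∪ {w | τ * s ≤ -(τ / N) * Z w} := by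
    intro w hw
    have hw' : s * N < |Z w| := hw
    have h5 : τ * s ≤ τ / N * |Z w| := by
      have : τ / N * (s * N) = τ * s := by field_simp
      rw [← this]
      gcongr
    rcases le_total 0 (Z w) with h | h
    · left; rwa [abs_of_nonneg h] at h5
    · right
      rw [abs_of_nonpos h] at h5
      show τ * s ≤ -(τ / N) * Z w
      linarith
  refine (measure_mono hsub).trans ((measure_union_le _ _).trans ?_)
  rw [two_mul, ENNReal.ofReal_add (Real.exp_pos _).le (Real.exp_pos _).le]
  have hτN : |τ / N| = τ / N := abs_of_pos (by positivity)
  exact add_le_add (key _ hτN) (key _ (by rw [abs_neg, hτN]))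

/-- Exponential moments of a sum of bounded martingale differences. -/
theorem lintegral_exp_sum_le_of_condExp_eq_zero [IsProbabilityMeasure μ]
    {ℱ : ℕ → MeasurableSpace Ω} (hmono : Monotone ℱ) {a b : ℕ} (hab : a ≤ b)
    (hle : ∀ t, t ≤ b → ℱ t ≤ mΩ) {D : ℕ → Ω → ℝ} {L : ℝ}
    (hmeas : ∀ t, a ≤ t → t < b → StronglyMeasurable[ℱ (t + 1)] (D t))
    (hzero : ∀ t, a ≤ t → t < b → μ[D t | ℱ t] =ᵐ[μ] 0)
    (hbdd : ∀ t, a ≤ t → t < b → ∀ᵐ w ∂μ, |D t w| ≤ L) {θ : ℝ} (hθ : |θ| * L ≤ 1) :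
    ∫⁻ w, ENNReal.ofReal (Real.exp (θ * ∑ t ∈ Finset.Ico a b, D t w)) ∂μ
      ≤ ENNReal.ofReal (Real.exp (θ ^ 2 * L ^ 2 * (b - a : ℕ))) := by
  have hsm : ∀ e, a ≤ e → e ≤ b →
      StronglyMeasurable[ℱ e] fun w => Real.exp (θ * ∑ t ∈ Finset.Ico a e, D t w) := by
    intro e _ he
    refine Real.continuous_exp.comp_stronglyMeasurable (StronglyMeasurable.const_mul ?_ θ)
    refine Finset.stronglyMeasurable_fun_sum _ fun t ht => ?_
    have ht' := Finset.mem_Ico.mp ht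
    exact (hmeas t ht'.1 (by omega)).mono (hmono (by omega))
  have hint : ∀ e, a ≤ e → e ≤ b →
      Integrable (fun w => Real.exp (θ * ∑ t ∈ Finset.Ico a e, D t w)) μ := by
    intro e hae he
    refine Integrable.of_bound ((hsm e hae he).mono (hle e he)).aestronglyMeasurable
      (Real.exp (|θ| * ∑ t ∈ Finset.Ico a e, L)) ?_
    have h : ∀ᵐ w ∂μ, ∀ t ∈ Finset.Ico a e, |D t w| ≤ L := by
      rw [Finset.eventually_all]
      intro t ht
      have ht' := Finset.mem_Ico.mp ht
      exact hbdd t ht'.1 (by omega)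
    filter_upwards [h] with w hw
    rw [Real.norm_eq_abs, Real.abs_exp]
    refine Real.exp_le_exp.mpr ((le_abs_self _).trans ?_)
    rw [abs_mul]
    exact mul_le_mul_of_nonneg_left
      ((Finset.abs_sum_le_sum_abs _ _).trans (Finset.sum_le_sum hw)) (abs_nonneg _)
  have key : ∀ e, a ≤ e → e ≤ b → ∫ w, Real.exp (θ * ∑ t ∈ Finset.Ico a e, D t w) ∂μ
      ≤ Real.exp (θ ^ 2 * L ^ 2 * (e - a : ℕ)) := by
    intro e hae
    induction e, hae using Nat.le_induction with
    | base => intro _; simp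
    | succ e hae ih =>
      intro he
      have hih := ih (by omega)
      set F : Ω → ℝ := fun w => Real.exp (θ * ∑ t ∈ Finset.Ico a e, D t w) with hF
      have hDm : AEStronglyMeasurable (D e) μ :=
        ((hmeas e hae (by omega)).mono (hle (e + 1) he)).aestronglyMeasurable
      have hDi : Integrable (D e) μ := Integrable.of_bound hDm L (hbdd e hae (by omega))
      have hFi := hint e hae (by omega)
      have hFDi : Integrable (F * D e) μ := hFi.mul_bdd hDm (hbdd e hae (by omega))
      have horth : ∫ w, (F * D e) w ∂μ = 0 := by
        rw [← integral_condExp (hle e (by omega))]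
        have h1 := condExp_mul_of_stronglyMeasurable_left (hsm e hae (by omega)) hFDi hDi
        have h2 : μ[F * D e | ℱ e] =ᵐ[μ] 0 := by
          filter_upwards [h1, hzero e hae (by omega)] with w hw1 hw2
          rw [hw1, Pi.mul_apply, hw2]
          simp
        rw [integral_congr_ae h2]
        simp
      have hle' : ∀ᵐ w ∂μ, Real.exp (θ * ∑ t ∈ Finset.Ico a (e + 1), D t w)
          ≤ (1 + θ ^ 2 * L ^ 2) * F w + θ * (F * D e) w := by
        filter_upwards [hbdd e hae (by omega)] with w hw
        rw [Finset.sum_Ico_succ_top hae, mul_add, Real.exp_add]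
        have h1 : |θ * D e w| ≤ 1 := by
          rw [abs_mul]
          exact (mul_le_mul_of_nonneg_left hw (abs_nonneg _)).trans hθ
        have h2 := (le_abs_self _).trans (Real.abs_exp_sub_one_sub_id_le h1)
        have h3 : (θ * D e w) ^ 2 ≤ θ ^ 2 * L ^ 2 := by
          rw [mul_pow]
          refine mul_le_mul_of_nonneg_left ?_ (sq_nonneg _)
          rw [← sq_abs]
          exact pow_le_pow_left₀ (abs_nonneg _) hw 2
        have h4 : Real.exp (θ * D e w) ≤ 1 + θ ^ 2 * L ^ 2 + θ * D e w := by linarith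
        have h5 := mul_le_mul_of_nonneg_left h4 (Real.exp_pos (θ * ∑ t ∈ Finset.Ico a e, D t w)).le
        rw [Pi.mul_apply]
        refine h5.trans (le_of_eq ?_)
        rw [hF]
        ring
      have hR1 : Integrable (fun w => (1 + θ ^ 2 * L ^ 2) * F w) μ := hFi.const_mul _
      have hR2 : Integrable (fun w => θ * (F * D e) w) μ := hFDi.const_mul _
      refine (integral_mono_ae (hint (e + 1) (by omega) he) (hR1.add hR2) hle').trans ?_
      have hsum : ∫ w, ((1 + θ ^ 2 * L ^ 2) * F w + θ * (F * D e) w) ∂μ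
          = (1 + θ ^ 2 * L ^ 2) * ∫ w, F w ∂μ := by
        rw [integral_add hR1 hR2, integral_const_mul, integral_const_mul, horth]
        ring
      refine hsum.le.trans ?_
      have h6 : 1 + θ ^ 2 * L ^ 2 ≤ Real.exp (θ ^ 2 * L ^ 2) := by
        linarith [Real.add_one_le_exp (θ ^ 2 * L ^ 2)]
      have h7 : (e + 1 - a : ℕ) = (e - a : ℕ) + 1 := by omega
      rw [h7]
      push_cast
      rw [mul_add, mul_one, Real.exp_add, mul_comm (Real.exp _)]
      have h8 : 0 ≤ ∫ w, F w ∂μ := integral_nonneg fun w => (Real.exp_pos _).le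
      exact mul_le_mul h6 hih h8 (Real.exp_pos _).le
  rw [← ofReal_integral_eq_lintegral_ofReal (hint b hab le_rfl)
    (Filter.Eventually.of_forall fun w => (Real.exp_pos _).le)]
  exact ENNReal.ofReal_le_ofReal (key b hab le_rfl)

end

/-- The exponential moments of a centred Poisson variable. -/
theorem lintegral_exp_poisson (r : ℝ≥0) (α : ℝ) :
    ∫⁻ n : ℕ, ENNReal.ofReal (Real.exp (α * ((n : ℝ) - r))) ∂poissonMeasure r
      = ENNReal.ofReal (Real.exp (r * (Real.exp α - 1 - α))) := by
  rw [poissonMeasure, lintegral_sum_measure]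
  simp only [lintegral_smul_measure, lintegral_dirac, smul_eq_mul]
  have h1 : ∀ n : ℕ, ENNReal.ofReal (Real.exp (-r) * (r : ℝ) ^ n / n.factorial)
      * ENNReal.ofReal (Real.exp (α * ((n : ℝ) - r)))
      = ENNReal.ofReal (Real.exp (-r - α * r) * ((r * Real.exp α) ^ n / n.factorial)) := by
    intro n
    rw [← ENNReal.ofReal_mul (by positivity)]
    congr 1
    rw [mul_pow, ← Real.exp_nat_mul]
    have h2 : Real.exp (α * ((n : ℝ) - r)) = Real.exp (n * α) * Real.exp (-(α * r)) := by
      rw [← Real.exp_add]; ring_nf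
    have h3 : Real.exp (-r - α * r) = Real.exp (-r) * Real.exp (-(α * r)) := by
      rw [← Real.exp_add]; ring_nf
    rw [h2, h3]
    ring
  simp_rw [h1]
  have h4 : HasSum (fun n : ℕ => Real.exp (-r - α * r) * ((r * Real.exp α) ^ n / n.factorial))
      (Real.exp (-r - α * r) * Real.exp (r * Real.exp α)) := by
    have h5 := NormedSpace.expSeries_div_hasSum_exp ((r : ℝ) * Real.exp α)
    rw [← Real.exp_eq_exp_ℝ] at h5
    exact h5.mul_left _
  rw [← ENNReal.ofReal_tsum_of_nonneg (fun n => by positivity) h4.summable, h4.tsum_eq,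
    ← Real.exp_add]
  congr 2
  ring

/-! ### Exponential moments of the innovations -/

section

variable {Ω : Type*} {X : ℕ → Ω → Fin M → ℤ}

theorem sigmaHistory_mono : Monotone (sigmaHistory X) := fun _ _ hst =>
  biSup_mono fun _ hs => ⟨hs.1, hs.2.trans hst⟩

theorem measurable_history_comp {β : Type*} [MeasurableSpace β] {t : ℕ}
    (f : Matrix (Fin M) (Fin t) ℤ → β) :
    Measurable[sigmaHistory X t] fun w => f (history (fun s => X s w) t) := by
  have h1 : Measurable[sigmaHistory X t]
      fun w => fun (m : Fin M) (s : Fin t) => X (s + 1) w m := by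
    let _ : MeasurableSpace Ω := sigmaHistory X t
    refine measurable_pi_lambda _ fun m => measurable_pi_lambda _ fun s => ?_
    have h2 : Measurable (X (s + 1)) := by
      refine Measurable.mono (comap_measurable (X (s + 1))) ?_ le_rfl
      exact le_biSup (fun s => MeasurableSpace.comap (X s) inferInstance)
        (show (s : ℕ) + 1 ∈ Set.Icc 1 t from ⟨by omega, s.2⟩)
    exact (measurable_pi_apply m).comp h2
  exact (Measurable.of_discrete (f := fun h : Fin M → Fin t → ℤ => f (Matrix.of h))).comp h1

theorem history_eq_of_history_eq {x y : ℕ → Fin M → ℤ} {e : ℕ} (h : history x e = history y e) :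
    (∀ t, 1 ≤ t → t ≤ e → x t = y t) ∧ ∀ t ≤ e, history x t = history y t := by
  have h1 : ∀ t, 1 ≤ t → t ≤ e → x t = y t := by
    intro t ht hte
    funext m
    have := congrFun (congrFun h m) ⟨t - 1, by omega⟩
    simpa [history, Nat.sub_add_cancel ht] using this
  refine ⟨h1, fun t ht => ?_⟩
  ext m s
  simp only [history, Matrix.of_apply]
  rw [h1 _ (by omega) (by omega)]

/-- The innovation in coordinate `m` at time `t + 1` times feature `j` at time `t`. -/
noncomputable def innovation (X : ℕ → Ω → Fin M → ℤ) (v : ℝ) (g : Features M)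
    (A : ℕ → Matrix (Fin M) (Fin M) ℝ) (m j : Fin M) (t : ℕ) (w : Ω) : ℝ :=
  ((X (t + 1) w m : ℝ) - Real.exp (logIntensity v g (A t) (history (fun s => X s w) t) m))
    * feature g (history (fun s => X s w) t) j

theorem innovation_congr {v : ℝ} {g : Features M} {A : ℕ → Matrix (Fin M) (Fin M) ℝ}
    {m j : Fin M} {e t : ℕ} (ht : t < e) {w w' : Ω}
    (h : history (fun s => X s w) e = history (fun s => X s w') e) :
    innovation X v g A m j t w = innovation X v g A m j t w' := by
  obtain ⟨h1, h2⟩ := history_eq_of_history_eq h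
  unfold innovation
  have h3 : X (t + 1) w = X (t + 1) w' := h1 (t + 1) (by omega) (by omega)
  rw [h2 t (by omega), h3]

variable [mΩ : MeasurableSpace Ω] {μ : Measure Ω}

theorem sigmaHistory_le {T : ℕ} (hX : ∀ t, 1 ≤ t → t ≤ T → Measurable (X t)) {t : ℕ}
    (ht : t ≤ T) : sigmaHistory X t ≤ mΩ :=
  iSup₂_le fun s hs => (hX s hs.1 (hs.2.trans ht)).comap_le

variable {T : ℕ} {v : ℝ} {g : Features M}
  {A : ℕ → Matrix (Fin M) (Fin M) ℝ} {P : IntervalPartition T}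

theorem IsSEPP.measurable_innovation (h : IsSEPP μ T X v g A P) (m j : Fin M) {t : ℕ}
    (ht : t < T) : Measurable (innovation X v g A m j t) := by
  have hX : Measurable (X (t + 1)) := h.measurable (t + 1) (by omega) (by omega)
  have hσ := sigmaHistory_le h.measurable ht.le
  have h1 : Measurable fun w => (X (t + 1) w m : ℝ) :=
    (Measurable.of_discrete (f := fun z : ℤ => (z : ℝ))).comp ((measurable_pi_apply m).comp hX)
  have h2 := (measurable_history_comp (X := X) (t := t)
    fun H => Real.exp (logIntensity v g (A t) H m)).mono hσ le_rfl
  have h3 := (measurable_history_comp (X := X) (t := t) fun H => feature g H j).mono hσ le_rfl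
  exact (h1.sub h2).mul h3

variable [IsProbabilityMeasure μ]

theorem IsSEPP.lintegral_exp_fibre (h : IsSEPP μ T X v g A P) {t : ℕ} (h1 : 1 ≤ t) (hT : t < T)
    (H : Matrix (Fin M) (Fin t) ℤ) (m : Fin M) (α : ℝ) :
    ∫⁻ w in {w | history (fun s => X s w) t = H},
        ENNReal.ofReal (Real.exp (α * ((X (t + 1) w m : ℝ)
          - Real.exp (logIntensity v g (A t) H m)))) ∂μ
      = μ {w | history (fun s => X s w) t = H} * ENNReal.ofReal (Real.exp
          (Real.exp (logIntensity v g (A t) H m) * (Real.exp α - 1 - α))) := by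
  set s := {w | history (fun s => X s w) t = H} with hs
  by_cases h0 : μ s = 0
  · rw [setLIntegral_measure_zero _ _ h0, h0, zero_mul]
  set Λ := Real.exp (logIntensity v g (A t) H m) with hΛ
  have hΛ0 : 0 ≤ Λ := (Real.exp_pos _).le
  have hlaw := h.conditional_law t h1 hT H h0
  have hX : Measurable (X (t + 1)) := h.measurable (t + 1) (by omega) (by omega)
  have hmeas : Measurable fun z : ℤ => ENNReal.ofReal (Real.exp (α * ((z : ℝ) - Λ))) :=
    Measurable.of_discrete
  -- the conditional law of coordinate `m`
  have h2 : ∫⁻ w, ENNReal.ofReal (Real.exp (α * ((X (t + 1) w m : ℝ) - Λ))) ∂(μ[|s])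
      = ENNReal.ofReal (Real.exp (Λ * (Real.exp α - 1 - α))) := by
    have e1 := lintegral_map (μ := μ[|s]) (hmeas.comp (measurable_pi_apply m)) hX
    have e2 := (measurePreserving_eval (fun m => (poissonMeasure
      (Real.exp (logIntensity v g (A t) H m)).toNNReal).map (fun n : ℕ => (n : ℤ))) m).lintegral_comp
      hmeas
    have e3 := lintegral_map (μ := poissonMeasure Λ.toNNReal) hmeas
      (Measurable.of_discrete (f := fun n : ℕ => (n : ℤ)))
    have e4 := lintegral_exp_poisson Λ.toNNReal α
    rw [Real.coe_toNNReal _ hΛ0] at e4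
    refine e1.symm.trans ?_
    rw [hlaw]
    refine e2.trans (e3.trans ?_)
    rw [← e4]
    simp
  have h3 : μ s ≠ ∞ := measure_ne_top _ _
  rw [ProbabilityTheory.cond, lintegral_smul_measure, smul_eq_mul] at h2
  rw [← h2, ← mul_assoc, ENNReal.mul_inv_cancel h0 h3, one_mul]

/-- Exponential moments of sums of innovations, by conditioning on the history. -/
theorem IsSEPP.lintegral_exp_innovation_le (h : IsSEPP μ T X v g A P) {Cg : ℝ} (hCg : 0 ≤ Cg)
    (hg : BoundedFeatures T v g Cg) (hball : ∀ t, 1 ≤ t → t ≤ T → A t ∈ rowBall M)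
    (m j : Fin M) {a b : ℕ} (ha : 1 ≤ a) (hab : a ≤ b) (hb : b ≤ T) {θ : ℝ}
    (hθ : |θ| * Cg ≤ 1) :
    ∫⁻ w, ENNReal.ofReal (Real.exp (θ * ∑ t ∈ Finset.Ico a b, innovation X v g A m j t w)) ∂μ
      ≤ ENNReal.ofReal (Real.exp (θ ^ 2 * (Real.exp (2 * Cg) * Cg ^ 2) * (b - a : ℕ))) := by
  induction b, hab using Nat.le_induction with
  | base => simp
  | succ e hae ih =>
    set V := Real.exp (2 * Cg) * Cg ^ 2 with hV
    have hih := ih (by omega)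
    set F : Ω → ℝ := fun w =>
      Real.exp (θ * ∑ t ∈ Finset.Ico a e, innovation X v g A m j t w) with hF
    have : Countable (Matrix (Fin M) (Fin e) ℤ) :=
      inferInstanceAs (Countable (Fin M → Fin e → ℤ))
    have hcover : (⋃ H : Matrix (Fin M) (Fin e) ℤ, {w | history (fun s => X s w) e = H})
        = Set.univ := Set.eq_univ_of_forall fun w => Set.mem_iUnion.mpr ⟨_, rfl⟩
    have hms : ∀ H : Matrix (Fin M) (Fin e) ℤ,
        MeasurableSet {w | history (fun s => X s w) e = H} := fun H =>
      measurableSet_setOfPred.mpr ((measurable_history_comp (X := X) (t := e)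
        fun H' => H' = H).mono (sigmaHistory_le h.measurable (by omega)) le_rfl)
    have hdisj : Pairwise (Function.onFun Disjoint
        fun H : Matrix (Fin M) (Fin e) ℤ => {w | history (fun s => X s w) e = H}) := by
      intro H H' hne
      refine Set.disjoint_left.mpr fun w hw hw' => hne ?_
      rw [← show history (fun s => X s w) e = H from hw,
        ← show history (fun s => X s w) e = H' from hw']
    have hsplit : ∀ G : Ω → ℝ≥0∞, ∫⁻ w, G w ∂μ = ∑' H : Matrix (Fin M) (Fin e) ℤ,
        ∫⁻ w in {w | history (fun s => X s w) e = H}, G w ∂μ := by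
      intro G
      rw [← lintegral_iUnion hms hdisj, hcover, setLIntegral_univ]
    have hfib : ∀ H : Matrix (Fin M) (Fin e) ℤ,
        ∫⁻ w in {w | history (fun s => X s w) e = H}, ENNReal.ofReal (Real.exp
          (θ * ∑ t ∈ Finset.Ico a (e + 1), innovation X v g A m j t w)) ∂μ
        ≤ ENNReal.ofReal (Real.exp (θ ^ 2 * V))
          * ∫⁻ w in {w | history (fun s => X s w) e = H}, ENNReal.ofReal (F w) ∂μ := by
      intro H
      rcases Set.eq_empty_or_nonempty {w | history (fun s => X s w) e = H} with hempty | ⟨w₀, hw₀⟩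
      · rw [hempty]; simp
      set α := θ * feature g H j with hα
      set Λ := Real.exp (logIntensity v g (A e) H m) with hΛ
      have hFc : ∀ w ∈ {w | history (fun s => X s w) e = H}, F w = F w₀ := by
        intro w hw
        simp only [hF]
        congr 2
        refine Finset.sum_congr rfl fun t ht => ?_
        exact innovation_congr (Finset.mem_Ico.mp ht).2
          ((show _ = H from hw).trans (show _ = H from hw₀).symm)
      have e1 : ∫⁻ w in {w | history (fun s => X s w) e = H}, ENNReal.ofReal (Real.exp
            (θ * ∑ t ∈ Finset.Ico a (e + 1), innovation X v g A m j t w)) ∂μ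
          = ∫⁻ w in {w | history (fun s => X s w) e = H}, ENNReal.ofReal (F w₀)
            * ENNReal.ofReal (Real.exp (α * ((X (e + 1) w m : ℝ) - Λ))) ∂μ := by
        refine setLIntegral_congr_fun (hms H) fun w hw => ?_
        rw [← hFc w hw, ← ENNReal.ofReal_mul (Real.exp_pos _).le, ← Real.exp_add,
          Finset.sum_Ico_succ_top hae]
        congr 2
        rw [mul_add]
        congr 1
        rw [innovation, show history (fun s => X s w) e = H from hw]
        ring
      have e2 : ∫⁻ w in {w | history (fun s => X s w) e = H}, ENNReal.ofReal (F w) ∂μ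
          = ENNReal.ofReal (F w₀) * μ {w | history (fun s => X s w) e = H} := by
        rw [← setLIntegral_const]
        refine setLIntegral_congr_fun (hms H) fun w hw => ?_
        rw [hFc w hw]
      rw [e1, lintegral_const_mul' _ _ ENNReal.ofReal_ne_top,
        h.lintegral_exp_fibre (by omega) (by omega), e2]
      have hgH := abs_feature_le hg (t := e) (by omega) (by omega) H j
      have hα1 : |α| ≤ 1 := by
        rw [hα, abs_mul]
        exact (mul_le_mul_of_nonneg_left hgH (abs_nonneg _)).trans hθ
      have hα2 : α ^ 2 ≤ θ ^ 2 * Cg ^ 2 := by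
        rw [hα, mul_pow]
        refine mul_le_mul_of_nonneg_left ?_ (sq_nonneg _)
        rw [← sq_abs]
        exact pow_le_pow_left₀ (abs_nonneg _) hgH 2
      have e3 : Λ * (Real.exp α - 1 - α) ≤ θ ^ 2 * V := by
        have e4 := (le_abs_self _).trans (Real.abs_exp_sub_one_sub_id_le hα1)
        have e5 : Λ ≤ Real.exp (2 * Cg) := Real.exp_le_exp.mpr ((le_abs_self _).trans
          (abs_logIntensity_le hg hCg (hball e (by omega) (by omega)) (t := e) (by omega)
            (by omega) H m))
        have e6 : Λ * (Real.exp α - 1 - α) ≤ Λ * (θ ^ 2 * Cg ^ 2) :=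
          mul_le_mul_of_nonneg_left (e4.trans hα2) (Real.exp_pos _).le
        have e7 : Λ * (θ ^ 2 * Cg ^ 2) ≤ Real.exp (2 * Cg) * (θ ^ 2 * Cg ^ 2) :=
          mul_le_mul_of_nonneg_right e5 (by positivity)
        refine e6.trans (e7.trans (le_of_eq ?_))
        rw [hV]
        ring
      have e8 := ENNReal.ofReal_le_ofReal (Real.exp_le_exp.mpr e3)
      calc ENNReal.ofReal (F w₀) * (μ {w | history (fun s => X s w) e = H}
            * ENNReal.ofReal (Real.exp (Λ * (Real.exp α - 1 - α))))
          ≤ ENNReal.ofReal (F w₀) * (μ {w | history (fun s => X s w) e = H}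
            * ENNReal.ofReal (Real.exp (θ ^ 2 * V))) := by gcongr
        _ = _ := by ring
    rw [hsplit]
    refine (ENNReal.tsum_le_tsum hfib).trans ?_
    rw [ENNReal.tsum_mul_left, ← hsplit]
    refine (mul_le_mul_right hih _).trans (le_of_eq ?_)
    rw [← ENNReal.ofReal_mul (Real.exp_pos _).le, ← Real.exp_add]
    congr 2
    rw [show e + 1 - a = (e - a) + 1 by omega]
    push_cast
    ring

end

/-! ### The Gram matrices of the features -/

section

variable {Ω : Type*} {X : ℕ → Ω → Fin M → ℤ}

/-- The product of features `i` and `j` at time `t`. -/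
noncomputable def featureProd (X : ℕ → Ω → Fin M → ℤ) (g : Features M) (i j : Fin M) (t : ℕ)
    (w : Ω) : ℝ :=
  feature g (history (fun s => X s w) t) i * feature g (history (fun s => X s w) t) j

/-- The martingale difference `E[Y_t | X(1), …, X(t - q)] - E[Y_t | X(1), …, X(t - q - 1)]` for
the product `Y_t` of two features. Summed over `q < p`, these differences telescope to
`Y_t - E[Y_t | X(1), …, X(t - p)]`. -/
noncomputable def gramIncrement [MeasurableSpace Ω] (μ : Measure Ω) (X : ℕ → Ω → Fin M → ℤ)
    (g : Features M) (i j : Fin M) (q t : ℕ) : Ω → ℝ :=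
  μ[featureProd X g i j t | sigmaHistory X (t - q)]
    - μ[featureProd X g i j t | sigmaHistory X (t - (q + 1))]

theorem stronglyMeasurable_featureProd (g : Features M) (i j : Fin M) (t : ℕ) :
    StronglyMeasurable[sigmaHistory X t] (featureProd X g i j t) := by
  have h := measurable_history_comp (X := X) (t := t) fun H => feature g H i * feature g H j
  exact h.stronglyMeasurable

variable {T : ℕ} {v : ℝ} {g : Features M} {Cg : ℝ}

theorem abs_featureProd_le (hCg : 0 ≤ Cg) (hg : BoundedFeatures T v g Cg) (i j : Fin M) {t : ℕ}
    (h1 : 1 ≤ t) (hT : t < T) (w : Ω) : |featureProd X g i j t w| ≤ Cg ^ 2 := by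
  rw [featureProd, abs_mul, sq]
  exact mul_le_mul (abs_feature_le hg h1 hT _ i) (abs_feature_le hg h1 hT _ j) (abs_nonneg _) hCg

variable [mΩ : MeasurableSpace Ω] {μ : Measure Ω}

theorem abs_gramIncrement_le (hCg : 0 ≤ Cg) (hg : BoundedFeatures T v g Cg) (i j : Fin M)
    (q : ℕ) {t : ℕ} (h1 : 1 ≤ t) (hT : t < T) :
    ∀ᵐ w ∂μ, |gramIncrement μ X g i j q t w| ≤ 2 * Cg ^ 2 := by
  have h : ∀ᵐ w ∂μ, |featureProd X g i j t w| ≤ Cg ^ 2 :=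
    Filter.Eventually.of_forall fun w => abs_featureProd_le hCg hg i j h1 hT w
  filter_upwards [ae_bdd_abs_condExp_of_ae_bdd_abs (m := sigmaHistory X (t - q)) h,
    ae_bdd_abs_condExp_of_ae_bdd_abs (m := sigmaHistory X (t - (q + 1))) h] with w hw1 hw2
  rw [gramIncrement, Pi.sub_apply]
  refine (abs_sub _ _).trans ?_
  linarith

theorem aemeasurable_gramIncrement (hX : ∀ t, 1 ≤ t → t ≤ T → Measurable (X t)) (i j : Fin M)
    (q : ℕ) {t : ℕ} (hT : t < T) : AEMeasurable (gramIncrement μ X g i j q t) μ :=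
  ((stronglyMeasurable_condExp.mono (sigmaHistory_le hX (by omega))).aestronglyMeasurable.sub
    (stronglyMeasurable_condExp.mono
      (sigmaHistory_le hX (by omega))).aestronglyMeasurable).aemeasurable

theorem measure_biUnion_le_ofReal {ι : Type*} {s : Finset ι} {E : ι → Set Ω} {δ ε : ℝ}
    (hE : ∀ i ∈ s, μ (E i) ≤ ENNReal.ofReal δ) (hε : s.card * δ ≤ ε) :
    μ (⋃ i ∈ s, E i) ≤ ENNReal.ofReal ε := by
  refine (measure_biUnion_finset_le s E).trans ((Finset.sum_le_sum hE).trans ?_)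
  rw [Finset.sum_const, nsmul_eq_mul, ← ENNReal.ofReal_natCast,
    ← ENNReal.ofReal_mul (Nat.cast_nonneg _)]
  exact ENNReal.ofReal_le_ofReal hε

variable [IsProbabilityMeasure μ]

theorem integrable_featureProd (hX : ∀ t, 1 ≤ t → t ≤ T → Measurable (X t)) (hCg : 0 ≤ Cg)
    (hg : BoundedFeatures T v g Cg) (i j : Fin M) {t : ℕ} (h1 : 1 ≤ t) (hT : t < T) :
    Integrable (featureProd X g i j t) μ :=
  Integrable.of_bound (((stronglyMeasurable_featureProd g i j t).mono
    (sigmaHistory_le hX hT.le)).aestronglyMeasurable) (Cg ^ 2)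
    (Filter.Eventually.of_forall fun w => abs_featureProd_le hCg hg i j h1 hT w)

/-- The products of features minus their conditional expectations are sums of `p` martingale
differences. -/
theorem featureProd_sub_condExp (hX : ∀ t, 1 ≤ t → t ≤ T → Measurable (X t)) (hCg : 0 ≤ Cg)
    (hg : BoundedFeatures T v g Cg) (i j : Fin M) (p : ℕ) {t : ℕ} (h1 : 1 ≤ t) (hT : t < T)
    (w : Ω) :
    featureProd X g i j t w - (μ[featureProd X g i j t | sigmaHistory X (t - p)]) w
      = ∑ q ∈ Finset.range p, gramIncrement μ X g i j q t w := by
  have h := Finset.sum_range_sub'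
    (fun q => (μ[featureProd X g i j t | sigmaHistory X (t - q)]) w) p
  rw [Nat.sub_zero, condExp_of_stronglyMeasurable (sigmaHistory_le hX hT.le)
    (stronglyMeasurable_featureProd g i j t) (integrable_featureProd hX hCg hg i j h1 hT)] at h
  rw [← h]
  rfl

theorem lintegral_exp_gramIncrement_le (hX : ∀ t, 1 ≤ t → t ≤ T → Measurable (X t))
    (hCg : 0 ≤ Cg) (hg : BoundedFeatures T v g Cg) (i j : Fin M) (q : ℕ) {a b : ℕ} (ha : 1 ≤ a)
    (hab : a ≤ b) (hb : b ≤ T) {θ : ℝ} (hθ : |θ| * (2 * Cg ^ 2) ≤ 1) :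
    ∫⁻ w, ENNReal.ofReal (Real.exp (θ * ∑ t ∈ Finset.Ico a b, gramIncrement μ X g i j q t w)) ∂μ
      ≤ ENNReal.ofReal (Real.exp (θ ^ 2 * (2 * Cg ^ 2) ^ 2 * (b - a : ℕ))) := by
  have hshift : ∀ t, sigmaHistory X (t - q) = sigmaHistory X (t + 1 - (q + 1)) := fun t => by
    rw [Nat.add_sub_add_right]
  refine lintegral_exp_sum_le_of_condExp_eq_zero (ℱ := fun t => sigmaHistory X (t - (q + 1)))
    (fun s t hst => sigmaHistory_mono (by omega)) hab
    (fun t ht => sigmaHistory_le hX (by omega)) (fun t hta htb => ?_) (fun t hta htb => ?_)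
    (fun t hta htb => abs_gramIncrement_le hCg hg i j q (by omega) (by omega)) hθ
  · have h1 : StronglyMeasurable[sigmaHistory X (t - q)]
        (μ[featureProd X g i j t | sigmaHistory X (t - q)]) := stronglyMeasurable_condExp
    have h2 : StronglyMeasurable[sigmaHistory X (t - (q + 1))]
        (μ[featureProd X g i j t | sigmaHistory X (t - (q + 1))]) := stronglyMeasurable_condExp
    rw [← hshift t]
    exact h1.sub (h2.mono (sigmaHistory_mono (by omega)))
  · have hle1 : sigmaHistory X (t - q) ≤ mΩ := sigmaHistory_le hX (by omega)
    have hle2 : sigmaHistory X (t - (q + 1)) ≤ mΩ := sigmaHistory_le hX (by omega)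
    have h1 := condExp_sub (μ := μ)
      (integrable_condExp (f := featureProd X g i j t) (m := sigmaHistory X (t - q)))
      (integrable_condExp (f := featureProd X g i j t) (m := sigmaHistory X (t - (q + 1))))
      (sigmaHistory X (t - (q + 1)))
    have h2 := condExp_condExp_of_le (μ := μ) (f := featureProd X g i j t)
      (sigmaHistory_mono (X := X) (show t - (q + 1) ≤ t - q by omega)) hle1
    have h3 : μ[μ[featureProd X g i j t | sigmaHistory X (t - (q + 1))]
        | sigmaHistory X (t - (q + 1))] = μ[featureProd X g i j t | sigmaHistory X (t - (q + 1))] :=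
      condExp_of_stronglyMeasurable hle2 stronglyMeasurable_condExp integrable_condExp
    filter_upwards [h1, h2] with w hw1 hw2
    refine hw1.trans ?_
    rw [Pi.sub_apply, hw2, h3, sub_self]
    rfl

/-! ### The probability of the good event -/

/-- A deviation level, in units of `log (T * M)` times the square root of the length of the
interval, at which Chernoff's bound with exponent `τ` and variance `V` gives a probability of at
most `(T * M)⁻³ / n`. -/
noncomputable def deviationLevel (τ V : ℝ) (n : ℕ) : ℝ :=
  (3 + (V + Real.log (2 * n)) / Real.log 2) / τ

theorem deviationLevel_pos {τ V : ℝ} {n : ℕ} (hτ : 0 < τ) (hV : 0 ≤ V) (hn : 1 ≤ n) :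
    0 < deviationLevel τ V n := by
  have h1 : (1 : ℝ) ≤ n := by exact_mod_cast hn
  have h2 : 0 ≤ Real.log (2 * n) := Real.log_nonneg (by linarith)
  have h3 : 0 < Real.log 2 := Real.log_pos (by norm_num)
  unfold deviationLevel
  positivity

theorem exp_deviationLevel_le {τ V r : ℝ} {n : ℕ} (hτ : 0 < τ) (hτ1 : τ ≤ 1) (hV : 0 ≤ V)
    (hn : 1 ≤ n) (hr : Real.log 2 ≤ r) :
    n * (2 * Real.exp (τ ^ 2 * V - τ * (deviationLevel τ V n * r))) ≤ Real.exp (-(3 * r)) := by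
  have h1 : (1 : ℝ) ≤ n := by exact_mod_cast hn
  have h2 : 0 ≤ Real.log (2 * n) := Real.log_nonneg (by linarith)
  have h3 : 0 < Real.log 2 := Real.log_pos (by norm_num)
  have h4 : τ * (deviationLevel τ V n * r)
      = 3 * r + (V + Real.log (2 * n)) * (r / Real.log 2) := by
    unfold deviationLevel
    field_simp
  have h5 : V + Real.log (2 * n) ≤ (V + Real.log (2 * n)) * (r / Real.log 2) :=
    le_mul_of_one_le_right (by positivity) ((one_le_div h3).mpr hr)
  have h6 : τ ^ 2 * V ≤ V := mul_le_of_le_one_left hV (pow_le_one₀ hτ.le hτ1)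
  have h7 : (n : ℝ) * (2 * Real.exp (τ ^ 2 * V - τ * (deviationLevel τ V n * r)))
      = Real.exp (Real.log (2 * n)) * Real.exp (τ ^ 2 * V - τ * (deviationLevel τ V n * r)) := by
    rw [Real.exp_log (by positivity)]
    ring
  rw [h7, ← Real.exp_add, Real.exp_le_exp]
  linarith

variable {A : ℕ → Matrix (Fin M) (Fin M) ℝ} {P : IntervalPartition T} {p : ℕ} {ω : ℝ}

/-- The path is good with high probability: a union bound over the pairs of end points of an
interval and the pairs of coordinates. -/
theorem IsSEPP.measure_not_goodPath_le (h : IsSEPP μ T X v g A P) (hp : 0 < p)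
    (hCg : 0 ≤ Cg) (hTM : (2 : ℝ) ≤ (T : ℝ) * M) (hg : BoundedFeatures T v g Cg)
    (hball : ∀ t, 1 ≤ t → t ≤ T → A t ∈ rowBall M) (heig : RestrictedEigenvalue μ T X g p ω)
    {σ₁ σ₂ : ℝ} (hσ₁ : σ₁ = deviationLevel (1 / (1 + Cg)) (Real.exp (2 * Cg) * Cg ^ 2) 1)
    (hσ₂ : σ₂ = deviationLevel (1 / (1 + 2 * Cg ^ 2)) ((2 * Cg ^ 2) ^ 2) p) :
    μ {w | ¬ ∃ Y, GoodPath T v g A p ω (σ₁ * Real.log ((T : ℝ) * M))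
        (p * (σ₂ * Real.log ((T : ℝ) * M))) (fun s => X s w) Y}
      ≤ ENNReal.ofReal (2 * ((T : ℝ) * M)⁻¹) := by
  set r := Real.log ((T : ℝ) * M) with hr
  have hTM0 : 0 < (T : ℝ) * M := by linarith
  have hr2 : Real.log 2 ≤ r := Real.log_le_log (by norm_num) hTM
  have hexp3 : Real.exp (-(3 * r)) = (((T : ℝ) * M) ^ 3)⁻¹ := by
    rw [Real.exp_neg, show 3 * r = ((3 : ℕ) : ℝ) * r by norm_num, Real.exp_nat_mul,
      Real.exp_log hTM0]
  set I : Finset (ℕ × ℕ × Fin M × Fin M) :=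
    (Finset.Icc 1 T ×ˢ Finset.Icc 1 T ×ˢ Finset.univ ×ˢ Finset.univ).filter
      fun i => i.1 < i.2.1 with hI
  have hIcard : (I.card : ℝ) ≤ ((T : ℝ) * M) ^ 2 := by
    have h1 : I.card ≤ T * (T * (M * M)) := by
      refine (Finset.card_filter_le _ _).trans (le_of_eq ?_)
      simp [Finset.card_product]
    have h2 : (I.card : ℝ) ≤ (T : ℝ) * (T * (M * M)) := by exact_mod_cast h1
    refine h2.trans (le_of_eq ?_)
    ring
  have hIδ : ∀ {n : ℕ} {δ : ℝ}, 0 ≤ δ → n * δ ≤ Real.exp (-(3 * r)) →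
      (I.card : ℝ) * n * δ ≤ ((T : ℝ) * M)⁻¹ := by
    intro n δ hδ hnδ
    rw [mul_assoc]
    refine (mul_le_mul hIcard hnδ (by positivity) (by positivity)).trans (le_of_eq ?_)
    rw [hexp3]
    field_simp
  have hImem : ∀ {i}, i ∈ I → 1 ≤ i.1 ∧ i.1 < i.2.1 ∧ i.2.1 ≤ T := by
    intro i hi
    simp only [hI, Finset.mem_filter, Finset.mem_product, Finset.mem_Icc] at hi
    omega
  -- the innovations
  set E₁ : ℕ × ℕ × Fin M × Fin M → Set Ω := fun i =>
    {w | σ₁ * r * Real.sqrt ((i.2.1 - i.1 : ℕ) : ℝ)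
      < |∑ t ∈ Finset.Ico i.1 i.2.1, innovation X v g A i.2.2.1 i.2.2.2 t w|} with hE₁
  have hμ₁ : μ (⋃ i ∈ I, E₁ i) ≤ ENNReal.ofReal ((T : ℝ) * M)⁻¹ := by
    have hτ : 0 < 1 / (1 + Cg) := by positivity
    have hτ1 : 1 / (1 + Cg) ≤ 1 := by rw [div_le_one (by positivity)]; linarith
    have hV : 0 ≤ Real.exp (2 * Cg) * Cg ^ 2 := by positivity
    have hdev := exp_deviationLevel_le (n := 1) hτ hτ1 hV le_rfl hr2
    rw [← hσ₁] at hdev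
    refine measure_biUnion_le_ofReal (E := E₁) (fun i hi => ?_)
      (by simpa only [Nat.cast_one, mul_one] using hIδ (by positivity) hdev)
    obtain ⟨h1, h2, h3⟩ := hImem hi
    refine measure_abs_gt_le (n := i.2.1 - i.1) ?_ (by omega) hτ (fun θ hθ => ?_) _
    · refine (Finset.measurable_fun_sum _ fun t ht => ?_).aemeasurable
      have ht' := Finset.mem_Ico.mp ht
      exact h.measurable_innovation _ _ (by omega)
    · refine h.lintegral_exp_innovation_le hCg hg hball _ _ h1 h2.le h3 ?_
      refine (mul_le_mul_of_nonneg_right hθ hCg).trans ?_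
      rw [one_div_mul_eq_div, div_le_one (by positivity)]
      linarith
  -- the Gram matrices
  set E₂ : (ℕ × ℕ × Fin M × Fin M) × ℕ → Set Ω := fun i =>
    {w | σ₂ * r * Real.sqrt ((i.1.2.1 - i.1.1 : ℕ) : ℝ)
      < |∑ t ∈ Finset.Ico i.1.1 i.1.2.1, gramIncrement μ X g i.1.2.2.1 i.1.2.2.2 i.2 t w|} with hE₂
  have hμ₂ : μ (⋃ i ∈ I ×ˢ Finset.range p, E₂ i) ≤ ENNReal.ofReal ((T : ℝ) * M)⁻¹ := by
    have hτ : 0 < 1 / (1 + 2 * Cg ^ 2) := by positivity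
    have hτ1 : 1 / (1 + 2 * Cg ^ 2) ≤ 1 := by
      rw [div_le_one (by positivity)]
      linarith [sq_nonneg Cg]
    have hV : 0 ≤ (2 * Cg ^ 2) ^ 2 := by positivity
    have hdev := exp_deviationLevel_le (n := p) hτ hτ1 hV hp hr2
    rw [← hσ₂] at hdev
    refine measure_biUnion_le_ofReal (E := E₂) (fun i hi => ?_)
      (by simpa only [Finset.card_product, Finset.card_range, Nat.cast_mul] using hIδ (by positivity) hdev)
    obtain ⟨h1, h2, h3⟩ := hImem (Finset.mem_product.mp hi).1
    refine measure_abs_gt_le (n := i.1.2.1 - i.1.1) ?_ (by omega) hτ (fun θ hθ => ?_) _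
    · refine Finset.aemeasurable_fun_sum _ fun t ht => ?_
      have ht' := Finset.mem_Ico.mp ht
      exact aemeasurable_gramIncrement h.measurable _ _ _ (by omega)
    · refine lintegral_exp_gramIncrement_le h.measurable hCg hg _ _ _ h1 h2.le h3 ?_
      refine (mul_le_mul_of_nonneg_right hθ (by positivity)).trans ?_
      rw [one_div_mul_eq_div, div_le_one (by positivity)]
      linarith
  -- the eigenvalues
  set Y : Ω → ℕ → Matrix (Fin M) (Fin M) ℝ := fun w t =>
    Matrix.of fun i j => (μ[featureProd X g i j t | sigmaHistory X (t - p)]) w with hY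
  set E₃ : Set Ω := {w | ¬ ∀ t ∈ Finset.Ioo p T, (Y w t - ω • (1 : Matrix (Fin M) (Fin M) ℝ)).PosDef}
    with hE₃
  have hμ₃ : μ E₃ = 0 := by
    have h1 : ∀ᵐ w ∂μ, ∀ t ∈ Finset.Ioo p T,
        (Y w t - ω • (1 : Matrix (Fin M) (Fin M) ℝ)).PosDef := by
      rw [Finset.eventually_all]
      intro t ht
      have ht' := Finset.mem_Ioo.mp ht
      exact heig t ht'.1 ht'.2
    exact h1
  have hsub : {w | ¬ ∃ Y, GoodPath T v g A p ω (σ₁ * r) (p * (σ₂ * r)) (fun s => X s w) Y}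
      ⊆ (⋃ i ∈ I, E₁ i) ∪ (⋃ i ∈ I ×ˢ Finset.range p, E₂ i) ∪ E₃ := by
    intro w hw
    by_contra hcon
    simp only [Set.mem_union, not_or] at hcon
    obtain ⟨⟨hw1, hw2⟩, hw3⟩ := hcon
    simp only [Set.mem_iUnion, not_exists] at hw1 hw2
    refine hw ⟨Y w, fun a b ha hab hb m j => ?_, fun t hpt htT ρ => ?_,
      fun a b ha hab hb i j => ?_⟩
    · rcases hab.eq_or_lt with rfl | hlt
      · simp
      have hi : (a, b, m, j) ∈ I := by
        simp only [hI, Finset.mem_filter, Finset.mem_product, Finset.mem_Icc, Finset.mem_univ,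
          and_true]
        omega
      exact not_lt.mp (hw1 _ hi)
    · have h1 := (not_not.mp hw3) t (Finset.mem_Ioo.mpr ⟨hpt, htT⟩)
      have h2 := h1.posSemidef.dotProduct_mulVec_nonneg ρ
      rw [Matrix.sub_mulVec, dotProduct_sub, Matrix.smul_mulVec, Matrix.one_mulVec,
        dotProduct_smul, sub_nonneg] at h2
      have h3 : star ρ ⬝ᵥ ρ = ∑ i, ρ i ^ 2 := by
        simp only [dotProduct, star_trivial, sq]
      have h4 : star ρ ⬝ᵥ (Y w t).mulVec ρ = ∑ i, ∑ j, ρ i * ρ j * Y w t i j := by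
        simp only [dotProduct, Matrix.mulVec, star_trivial, Finset.mul_sum]
        refine Finset.sum_congr rfl fun i _ => Finset.sum_congr rfl fun j _ => ?_
        ring
      rw [h3, h4, smul_eq_mul] at h2
      exact h2
    · rcases hab.eq_or_lt with rfl | hlt
      · simp
      have hi : (a, b, i, j) ∈ I := by
        simp only [hI, Finset.mem_filter, Finset.mem_product, Finset.mem_Icc, Finset.mem_univ,
          and_true]
        omega
      have h1 : ∑ t ∈ Finset.Ico a b, (feature g (history (fun s => X s w) t) i
          * feature g (history (fun s => X s w) t) j - Y w t i j)
          = ∑ q ∈ Finset.range p, ∑ t ∈ Finset.Ico a b, gramIncrement μ X g i j q t w := by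
        rw [Finset.sum_comm]
        refine Finset.sum_congr rfl fun t ht => ?_
        have ht' := Finset.mem_Ico.mp ht
        exact featureProd_sub_condExp h.measurable hCg hg i j p (by omega) (by omega) w
      rw [h1]
      refine (Finset.abs_sum_le_sum_abs _ _).trans ?_
      have h2 : ∀ q ∈ Finset.range p, |∑ t ∈ Finset.Ico a b, gramIncrement μ X g i j q t w|
          ≤ σ₂ * r * Real.sqrt ((b - a : ℕ) : ℝ) := fun q hq =>
        not_lt.mp (hw2 ((a, b, i, j), q) (Finset.mem_product.mpr ⟨hi, hq⟩))
      refine (Finset.sum_le_sum h2).trans (le_of_eq ?_)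
      rw [Finset.sum_const, Finset.card_range, nsmul_eq_mul]
      ring
  refine (measure_mono hsub).trans ((measure_union_le _ _).trans ?_)
  rw [hμ₃, add_zero]
  refine (measure_union_le _ _).trans ((add_le_add hμ₁ hμ₂).trans (le_of_eq ?_))
  rw [two_mul, ENNReal.ofReal_add (by positivity) (by positivity)]

end

end SEPP

theorem theorem1 (p : ℕ) (hp : 0 < p) (ω Cg C₁ : ℝ) (hω : 0 < ω) (hCg : 0 < Cg) (hC₁ : 0 < C₁) :
    ∃ Clam Cgam Ceps C₀ : ℝ, 0 < Clam ∧ 0 < Cgam ∧ 0 < Ceps ∧ 0 < C₀ ∧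
      ∀ (ξ C₂ : ℝ), 0 < ξ → 0 < C₂ →
      ∀ (T M : ℕ), C₀ ≤ C₂ * Real.log ((T : ℝ) * M) ^ ξ →
      ∀ (Ω : Type*) [MeasurableSpace Ω] (μ : Measure Ω) [IsProbabilityMeasure μ]
        (X : ℕ → Ω → Fin M → ℤ) (v : ℝ) (g : SEPP.Features M)
        (A : ℕ → Matrix (Fin M) (Fin M) ℝ) (P : SEPP.IntervalPartition T) (κ : ℝ)
        (S : Finset (Fin M × Fin M)), S.Nonempty →
        SEPP.IsSEPP μ T X v g A P →
        SEPP.IsMinJump A P κ →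
        SEPP.SupportedOn T A S →
        (∀ t, 1 ≤ t → t ≤ T → A t ∈ SEPP.rowBall M) →
        SEPP.SignalToNoise T M S.card P.minSpacing κ ξ C₁ C₂ →
        SEPP.RestrictedEigenvalue μ T X g p ω →
        SEPP.BoundedFeatures T v g Cg →
        ENNReal.ofReal (1 - 2 * ((T : ℝ) * M)⁻¹) ≤
          μ {w | ∀ Q : SEPP.IntervalPartition T,
            SEPP.IsPDPEstimate T v g
              (Clam * Real.log ((T : ℝ) * M))
              (Cgam * Real.log ((T : ℝ) * M) ^ 2 * (S.card : ℝ) *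
                (1 + (S.card : ℝ) * κ ^ (-2 : ℤ)))
              (fun t => X t w) Q →
            Q.K = P.K ∧ ∀ k, 1 ≤ k → k ≤ P.K →
              |(Q.η k : ℝ) - (P.η k : ℝ)| ≤
                Ceps * (S.card : ℝ) ^ 2 * Real.log ((T : ℝ) * M) ^ 2 *
                  max (κ ^ (-2 : ℤ)) (κ ^ (-4 : ℤ))} := by
  have hlog2 : 0 < Real.log 2 := Real.log_pos (by norm_num)
  set c' := Real.exp (-(2 * Cg)) / (4 * (1 + 2 * Cg)) with hc'
  set c := c' * ω with hc
  set σ₁ := SEPP.deviationLevel (1 / (1 + Cg)) (Real.exp (2 * Cg) * Cg ^ 2) 1 with hσ₁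
  set σ₂ := SEPP.deviationLevel (1 / (1 + 2 * Cg ^ 2)) ((2 * Cg ^ 2) ^ 2) p with hσ₂
  have hc'0 : 0 < c' := by positivity
  have hc0 : 0 < c := by positivity
  have hσ₁0 : 0 < σ₁ := SEPP.deviationLevel_pos (by positivity) (by positivity) le_rfl
  have hσ₂0 : 0 < σ₂ := SEPP.deviationLevel_pos (by positivity) (by positivity) hp
  -- `b * log (T * M)` bounds the `ℓ₁` error of restricted convexity
  set b := σ₁ + 2 * c' * (p * σ₂) + 2 * c * (p + 1) / Real.log 2 with hb
  have hb0 : 0 < b := by positivity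
  set Clam := b / C₁ with hClam
  set Cgam := (1 / C₁ + 2) * (2 / (c * C₁ ^ 3)) * Clam ^ 2 with hCgam
  set Ceps := 16 * Cgam / (c * C₁) with hCeps
  have hClam0 : 0 < Clam := by positivity
  have hCgam0 : 0 < Cgam := by positivity
  have hCeps0 : 0 < Ceps := by positivity
  refine ⟨Clam, Cgam, Ceps, 2 * Ceps + 1, hClam0, hCgam0, hCeps0, by positivity, ?_⟩
  intro ξ C₂ hξ hC₂ T M hC₀ Ω _ μ _ X v g A P κ S hS hX hκ hsupp hball hSN heig hg
  -- `C₀ > 0` excludes `T * M = 1`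
  have hT : 1 ≤ T := by
    have h := P.η_strictMono (Nat.succ_pos P.K) le_rfl
    rw [P.first, P.last] at h
    omega
  have hM : 1 ≤ M := by
    obtain ⟨q, _⟩ := hS
    have := q.1.2
    omega
  have hTM : (2 : ℝ) ≤ (T : ℝ) * M := by
    have h1 : 1 ≤ T * M := Nat.mul_pos hT hM
    have h2 : T * M ≠ 1 := by
      intro h
      have h3 : (T : ℝ) * M = 1 := by exact_mod_cast h
      rw [h3, Real.log_one, Real.zero_rpow hξ.ne', mul_zero] at hC₀
      linarith
    exact_mod_cast (by omega : 2 ≤ T * M)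
  set r := Real.log ((T : ℝ) * M) with hr
  have hr2 : Real.log 2 ≤ r := Real.log_le_log (by norm_num) hTM
  have hr0 : 0 < r := hlog2.trans_le hr2
  have hbr : σ₁ * r + 2 * c' * (p * (σ₂ * r)) + 2 * c * (p + 1) ≤ b * r := by
    have h1 : 2 * c * (p + 1) ≤ 2 * c * (p + 1) / Real.log 2 * r := by
      rw [div_mul_eq_mul_div, le_div_iff₀ hlog2]
      gcongr
    have h2 : b * r = σ₁ * r + 2 * c' * (p * (σ₂ * r)) + 2 * c * (p + 1) / Real.log 2 * r := by
      rw [hb]; ring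
    linarith
  have hsep : 2 * (Ceps * (S.card : ℝ) ^ 2 * r ^ 2 * max (κ ^ (-2 : ℤ)) (κ ^ (-4 : ℤ)))
      < P.minSpacing := by
    refine lt_of_lt_of_le ?_ hSN.2
    have h1 : r ^ (2 + ξ) = r ^ 2 * r ^ ξ := by
      rw [Real.rpow_add hr0]; norm_num
    have h2 : (0 : ℝ) < S.card := by exact_mod_cast hS.card_pos
    have h3 : 0 < max (κ ^ (-2 : ℤ)) (κ ^ (-4 : ℤ)) :=
      lt_max_of_lt_left (zpow_pos hκ.1 _)
    have h4 : 0 < (S.card : ℝ) ^ 2 * r ^ 2 * max (κ ^ (-2 : ℤ)) (κ ^ (-4 : ℤ)) := by positivity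
    have h5 := mul_le_mul_of_nonneg_right hC₀ h4.le
    rw [h1]
    nlinarith
  have hbad := hX.measure_not_goodPath_le hp hCg.le hTM hg hball heig hσ₁ hσ₂
  set G := {w | ∀ Q : SEPP.IntervalPartition T,
      SEPP.IsPDPEstimate T v g (Clam * r)
        (Cgam * r ^ 2 * (S.card : ℝ) * (1 + (S.card : ℝ) * κ ^ (-2 : ℤ))) (fun t => X t w) Q →
      Q.K = P.K ∧ ∀ k, 1 ≤ k → k ≤ P.K → |(Q.η k : ℝ) - (P.η k : ℝ)| ≤
        Ceps * (S.card : ℝ) ^ 2 * r ^ 2 * max (κ ^ (-2 : ℤ)) (κ ^ (-4 : ℤ))} with hG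
  have hsub : Gᶜ ⊆ {w | ¬ ∃ Y, SEPP.GoodPath T v g A p ω (σ₁ * r) (p * (σ₂ * r))
      (fun s => X s w) Y} := by
    rintro w hw ⟨Y, hY⟩
    exact hw fun Q hQ => hY.estimate hω (by positivity) (by positivity) hCg.le hC₁ hg
      hX.change_iff hκ hS hsupp hball hSN.1 hr0 hb0 hc' hc hbr hClam hCgam hCeps hsep hQ
  have h1 : (1 : ℝ≥0∞) ≤ μ G + ENNReal.ofReal (2 * ((T : ℝ) * M)⁻¹) := by
    calc (1 : ℝ≥0∞) = μ (G ∪ Gᶜ) := by rw [Set.union_compl_self, measure_univ]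
      _ ≤ μ G + μ Gᶜ := measure_union_le _ _
      _ ≤ _ := by
        gcongr
        exact (measure_mono hsub).trans hbad
  rw [ENNReal.ofReal_sub _ (by positivity), ENNReal.ofReal_one]
  exact tsub_le_iff_right.mpr h1
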